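/- **Conventions.** All spaces below (spaces of units and arrows of groupoids, groups, total spaces $Z$) are locally compact Hausdorff. A *Real* structure on a space is a continuous involution. A *Real groupoid* $(\mathcal G,\rho)$ is a topological groupoid $\mathcal G\rightrightarrows X$ with a Real structure that is a strict automorphism of $\mathcal G$; a *Real group* $(S,\bar{\ })$ is a topological group with a continuous involutive automorphism (written multiplicatively), and is viewed as a Real groupoid with one unit. A *Real generalized homomorphism* $(Z,\tau):(\mathcal G,\rho)\to(S,\bar{\ })$ is a Real space $(Z,\tau)$ with a continuous open surjective map $\mathfrak r:Z\to X$ satisfying $\mathfrak r(\tau(z))=\rho(\mathfrak r(z))$, a continuous left action of $\mathcal G$ along $\mathfrak r$ and a commuting continuous right action of $S$ preserving the fibres of $\mathfrak r$, such that $\tau(gz)=\rho(g)\tau(z)$, $\tau(zt)=\tau(z)\bar t$, and such that $\mathfrak r:Z\to X$ is a locally trivial principal $S$-bundle: it has continuous local sections, $(z,t)\mapsto(z,zt)$ is a homeomorphism $Z\times S\to Z\times_XZ$, and $Z$ is locally isomorphic to $U\times S$ as an $S$-bundle. $\operatorname{Hom}_{\mathfrak{RG}}(\mathcal G,S)$ is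 the set of isomorphism classes $[Z,\tau]$, isomorphisms being the $\mathcal G$-$S$-equivariant homeomorphisms over $X$ that intertwine the involutions. Let $\mathcal G_n$ be the space of strings of $n$ composable arrows of $\mathcal G$, i.e. of strict homomorphisms from the pair groupoid of $[n]=\{0,\dots,n\}$ to $\mathcal G$, with its involution $\rho_n$, and let $\tilde f:\mathcal G_n\to\mathcal G_m$ be the map induced by $f:[m]\to[n]$. Let $\varepsilon_k:[n]\to[n+1]$ be the increasing map that avoids $k$. A *Real open cover* of a Real space is an open cover $(U_j)_{j\in J}$ whose index set carries an involution $j\mapsto\bar j$ such that $U_{\bar j}$ is the image of $U_j$ under the Real structure; a Real open cover $\mathcal U=(\mathcal U_n)_n$ of $\mathcal G_\bullet$ is a sequence of Real open covers $\mathcal U_n=(U^n_j)_{j\in J_n}$ of $\mathcal G_n$. Its associated pre-simplicial cover ${}_\natural\mathcal U$ is indexed by the families $\lambda=(\lambda_\varphi)\in\Lambda_n$, $\lambda_\varphi\in J_k$ for $\varphi:[k]\to[n]$ strictly increasing, with $U^n_\lambda=\bigcap_\varphi\tilde\varphi^{-1}(U^k_{\lambda_\varphi})$, $(\bar\lambda)_\varphi=\overline{\lambda_\varphi}$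 and $(\tilde f\lambda)_\varphi=\lambda_{f\circ\varphi}$. A *Real $n$-cochain* is a family of continuous maps $c_\lambda:U^n_\lambda\to S$, $\lambda\in\Lambda_n$, with $c_{\bar\lambda}(\rho_n(x))=\overline{c_\lambda(x)}$; write $(\tilde f^*c)_\lambda=c_{\tilde f\lambda}\circ\tilde f$. A $1$-cochain $c$ is a *cocycle* if $\tilde\varepsilon_1^*c=\tilde\varepsilon_2^*c\cdot\tilde\varepsilon_0^*c$, and cocycles $c,c'$ are *cohomologous* if $c'=(\tilde\varepsilon_1^*\varphi)^{-1}\cdot c\cdot\tilde\varepsilon_0^*\varphi$ for a Real $0$-cochain $\varphi$; $HR^1(\mathcal U,S)$ is the set of cohomology classes, which for abelian $S$ is an abelian group (cocycles modulo coboundaries). Finally $$\check HR^1(\mathcal G_\bullet,S)=\varinjlim_{\mathcal U\in\mathfrak N(1)}HR^1(\mathcal U,S),$$ where $\mathfrak N(1)$ consists of the Real open covers $\mathcal U$ of $\mathcal G_\bullet$ such that for some $N\ge2$ the index sets $J_n$, $n\le N$, carry an action $\tilde f:J_n\to J_m$ of all nondecreasing maps $f:[m]\to[n]$, $m,n\le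 N$, functorial and compatible with the involutions, with $\tilde f(U^n_j)\subseteq U^m_{\tilde f(j)}$; and where the transition maps are restrictions along refinements (maps $\theta_n$ of index sets that commute with the involutions and satisfy $V^n_i\subseteq U^n_{\theta_n(i)}$). Every Real generalized homomorphism $(Z,\tau):\mathcal G\to S$ has, for some $\mathcal U\in\mathfrak N(1)$, continuous local sections $\mathsf s_\lambda:U^0_\lambda\to Z$ of $\mathfrak r$ ($\lambda\in\Lambda_0$) with $\mathsf s_{\bar\lambda}\circ\rho=\tau\circ\mathsf s_\lambda$, together with a Real $1$-cocycle $c$ over ${}_\natural\mathcal U$, called a *transition cocycle* of $Z$, such that, with $\lambda_0=\tilde\varepsilon_1\lambda$ and $\lambda_1=\tilde\varepsilon_0\lambda$, $$g\cdot\mathsf s_{\lambda_1}(s(g))=\mathsf s_{\lambda_0}(r(g))\cdot c_\lambda(g)\qquad(\lambda\in\Lambda_1,\ g\in U^1_\lambda).$$ **Proposition.** Let $(\mathcal G,\rho)$ be a Real groupoid with unit space $X$. 1. Let $S$ be an abelian Real group (with trivial $\mathcal G$-action). Then $\operatorname{Hom}_{\mathfrak{RG}}(\mathcal G,S)$ is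 an abelian group under $$[Z,\tau]+[Z',\tau']=[\,Z\times_XZ'/\!\sim,\ \tau\times\tau'\,],\qquad (z,z')\sim(zt^{-1},z't)\ \ (t\in S),$$ with actions $g[z,z']=[gz,gz']$ and $[z,z']t=[z,z't]$, the inverse of $[Z,\tau]$ being the class of $(Z,\tau)$ with the same left action and with right action $z\cdot t:=zt^{-1}$. There is a group isomorphism $\operatorname{Hom}_{\mathfrak{RG}}(\mathcal G,S)\cong\check HR^1(\mathcal G_\bullet,S)$ that sends $[Z,\tau]$ to the class of any transition cocycle of $Z$. 2. Let $S$ be any Real group, not necessarily abelian. Then there is a bijection from the set $\operatorname{Hom}_{\mathfrak{RG}}(\mathcal G,S)$ onto the set $\check HR^1(\mathcal G_\bullet,S)$ that sends $[Z,\tau]$ to the class of any transition cocycle of $Z$. -/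

import Mathlib

open Set Topology

universe u

/-- A locally compact Hausdorff topological groupoid `Arr ⇉ Obj`, together with a Real structure,
i.e. an involutive homeomorphic strict automorphism (`ρ₀` on units, `ρ` on arrows).
The arrow `g` goes from `s g` to `r g`, and `mul g h` is defined when `s g = r h`. -/
structure RealGroupoid where
  Obj : Type u
  Arr : Type u
  [topObj : TopologicalSpace Obj]
  [topArr : TopologicalSpace Arr]
  [t2Obj : T2Space Obj]
  [t2Arr : T2Space Arr]
  [lcObj : LocallyCompactSpace Obj]
  [lcArr : LocallyCompactSpace Arr]
  r : Arr → Obj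
  s : Arr → Obj
  unit : Obj → Arr
  inv : Arr → Arr
  mul : ∀ g h : Arr, s g = r h → Arr
  r_unit : ∀ x, r (unit x) = x
  s_unit : ∀ x, s (unit x) = x
  r_inv : ∀ g, r (inv g) = s g
  s_inv : ∀ g, s (inv g) = r g
  r_mul : ∀ g h (e : s g = r h), r (mul g h e) = r g
  s_mul : ∀ g h (e : s g = r h), s (mul g h e) = s h
  mul_assoc : ∀ g h k (e : s g = r h) (e' : s h = r k),
    mul (mul g h e) k ((s_mul g h e).trans e') = mul g (mul h k e') (e.trans (r_mul h k e').symm)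
  unit_mul : ∀ g, mul (unit (r g)) g (s_unit (r g)) = g
  mul_unit : ∀ g, mul g (unit (s g)) (r_unit (s g)).symm = g
  inv_mul : ∀ g, mul (inv g) g (s_inv g) = unit (s g)
  mul_inv : ∀ g, mul g (inv g) (r_inv g).symm = unit (r g)
  continuous_r : Continuous r
  continuous_s : Continuous s
  continuous_unit : Continuous unit
  continuous_inv : Continuous inv
  continuous_mul : Continuous fun p : {p : Arr × Arr // s p.1 = r p.2} => mul p.1.1 p.1.2 p.2
  ρ₀ : Obj → Obj
  ρ : Arr → Arr
  continuous_ρ₀ : Continuous ρ₀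
  continuous_ρ : Continuous ρ
  ρ₀_ρ₀ : ∀ x, ρ₀ (ρ₀ x) = x
  ρ_ρ : ∀ g, ρ (ρ g) = g
  r_ρ : ∀ g, r (ρ g) = ρ₀ (r g)
  s_ρ : ∀ g, s (ρ g) = ρ₀ (s g)
  ρ_unit : ∀ x, ρ (unit x) = unit (ρ₀ x)
  ρ_mul : ∀ g h (e : s g = r h),
    ρ (mul g h e) = mul (ρ g) (ρ h) (((s_ρ g).trans (congrArg ρ₀ e)).trans (r_ρ h).symm)

/-- A Real group: a locally compact Hausdorff topological group with a continuous involutive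
automorphism `conj`. -/
class RealGroup (S : Type u) [Group S] [TopologicalSpace S] extends
    IsTopologicalGroup S, T2Space S, LocallyCompactSpace S where
  conj : S →* S
  continuous_conj : Continuous conj
  conj_conj : ∀ t, conj (conj t) = t

namespace RealGroupoid

attribute [instance] topObj topArr t2Obj t2Arr lcObj lcArr

/-- A Real group, seen as a Real groupoid with one unit. -/
def ofGroup (S : Type u) [Group S] [TopologicalSpace S] [RealGroup S] : RealGroupoid.{u} where
  Obj := PUnit.{u + 1}
  Arr := S
  r _ := PUnit.unit
  s _ := PUnit.unit
  unit _ := 1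
  inv t := t⁻¹
  mul t t' _ := t * t'
  r_unit _ := rfl
  s_unit _ := rfl
  r_inv _ := rfl
  s_inv _ := rfl
  r_mul _ _ _ := rfl
  s_mul _ _ _ := rfl
  mul_assoc a b c _ _ := _root_.mul_assoc a b c
  unit_mul := one_mul
  mul_unit := mul_one
  inv_mul := inv_mul_cancel
  mul_inv := mul_inv_cancel
  continuous_r := continuous_const
  continuous_s := continuous_const
  continuous_unit := continuous_const
  continuous_inv := ContinuousInv.continuous_inv
  continuous_mul := by fun_prop
  ρ₀ x := x
  ρ t := RealGroup.conj t
  continuous_ρ₀ := continuous_id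
  continuous_ρ := RealGroup.continuous_conj
  ρ₀_ρ₀ _ := rfl
  ρ_ρ := RealGroup.conj_conj
  r_ρ _ := rfl
  s_ρ _ := rfl
  ρ_unit _ := map_one _
  ρ_mul a b _ := map_mul _ a b

end RealGroupoid

/-- A locally compact Hausdorff Real space `(Z, τ)` with commuting Real actions: a left action of
`Γ` along `rng : Z → Γ.Obj` and a right action of `G` along `src : Z → G.Obj`, where `rng` is
invariant under `G` and `src` is invariant under `Γ`. -/
structure RealBibundle (Γ G : RealGroupoid.{u}) where
  Z : Type u
  [topZ : TopologicalSpace Z]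
  [t2Z : T2Space Z]
  [lcZ : LocallyCompactSpace Z]
  τ : Z → Z
  continuous_τ : Continuous τ
  τ_τ : ∀ z, τ (τ z) = z
  rng : Z → Γ.Obj
  src : Z → G.Obj
  continuous_rng : Continuous rng
  isOpenMap_rng : IsOpenMap rng
  surjective_rng : Function.Surjective rng
  continuous_src : Continuous src
  isOpenMap_src : IsOpenMap src
  rng_τ : ∀ z, rng (τ z) = Γ.ρ₀ (rng z)
  src_τ : ∀ z, src (τ z) = G.ρ₀ (src z)
  lact : ∀ (γ : Γ.Arr) (z : Z), Γ.s γ = rng z → Z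
  ract : ∀ (z : Z) (g : G.Arr), src z = G.r g → Z
  continuous_lact : Continuous fun p : {p : Γ.Arr × Z // Γ.s p.1 = rng p.2} =>
    lact p.1.1 p.1.2 p.2
  continuous_ract : Continuous fun p : {p : Z × G.Arr // src p.1 = G.r p.2} =>
    ract p.1.1 p.1.2 p.2
  rng_lact : ∀ γ z (e : Γ.s γ = rng z), rng (lact γ z e) = Γ.r γ
  src_lact : ∀ γ z (e : Γ.s γ = rng z), src (lact γ z e) = src z
  src_ract : ∀ z g (e : src z = G.r g), src (ract z g e) = G.s g
  rng_ract : ∀ z g (e : src z = G.r g), rng (ract z g e) = rng z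
  unit_lact : ∀ z, lact (Γ.unit (rng z)) z (Γ.s_unit _) = z
  ract_unit : ∀ z, ract z (G.unit (src z)) (G.r_unit _).symm = z
  mul_lact : ∀ γ γ' z (e : Γ.s γ = Γ.r γ') (e' : Γ.s γ' = rng z),
    lact (Γ.mul γ γ' e) z ((Γ.s_mul γ γ' e).trans e') =
      lact γ (lact γ' z e') (e.trans (rng_lact γ' z e').symm)
  ract_mul : ∀ z g g' (e : src z = G.r g) (e' : G.s g = G.r g'),
    ract z (G.mul g g' e') (e.trans (G.r_mul g g' e').symm) =
      ract (ract z g e) g' ((src_ract z g e).trans e')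
  lact_ract : ∀ γ z g (e : Γ.s γ = rng z) (e' : src z = G.r g),
    lact γ (ract z g e') (e.trans (rng_ract z g e').symm) =
      ract (lact γ z e) g ((src_lact γ z e).trans e')
  τ_lact : ∀ γ z (e : Γ.s γ = rng z),
    τ (lact γ z e) = lact (Γ.ρ γ) (τ z) (((Γ.s_ρ γ).trans (congrArg Γ.ρ₀ e)).trans (rng_τ z).symm)
  τ_ract : ∀ z g (e : src z = G.r g),
    τ (ract z g e) = ract (τ z) (G.ρ g) (((src_τ z).trans (congrArg G.ρ₀ e)).trans (G.r_ρ g).symm)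

namespace RealBibundle

attribute [instance] topZ t2Z lcZ

variable {Γ G : RealGroupoid.{u}}

/-- The map `(z, g) ↦ (z, zg)` from `Z ×_{src, r} G` to `Z ×_{rng} Z`. -/
def shear (Z : RealBibundle Γ G) (p : {p : Z.Z × G.Arr // Z.src p.1 = G.r p.2}) :
    {q : Z.Z × Z.Z // Z.rng q.1 = Z.rng q.2} :=
  ⟨(p.1.1, Z.ract p.1.1 p.1.2 p.2), (Z.rng_ract _ _ _).symm⟩

/-- `rng : Z → Γ.Obj` is a principal `G`-bundle: it is locally split, and `(z, g) ↦ (z, zg)` is a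
homeomorphism onto the fibred product. -/
def IsPrincipal (Z : RealBibundle Γ G) : Prop :=
  (∀ y : Γ.Obj, ∃ U : Set Γ.Obj, IsOpen U ∧ y ∈ U ∧
    ∃ σ : C(U, Z.Z), ∀ u, Z.rng (σ u) = u) ∧
  IsHomeomorph Z.shear

/-- `rng : Z → Γ.Obj` is locally, as a `G`-bundle, of the form `U ×_{φ, r} G` for a continuous map
`φ : U → G.Obj`. -/
def IsLocallyTrivial (Z : RealBibundle Γ G) : Prop :=
  ∀ y : Γ.Obj, ∃ U : Set Γ.Obj, IsOpen U ∧ y ∈ U ∧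
    ∃ (φ : C(U, G.Obj)) (h : {z : Z.Z // Z.rng z ∈ U} ≃ₜ {p : U × G.Arr // φ p.1 = G.r p.2})
      (hs : ∀ z, G.s (h z).1.2 = Z.src z.1),
      (∀ z, ((h z).1.1 : Γ.Obj) = Z.rng z.1) ∧
      ∀ z g (e : Z.src z.1 = G.r g),
        (h ⟨Z.ract z.1 g e, (Z.rng_ract _ _ _).symm ▸ z.2⟩).1.2 =
          G.mul (h z).1.2 g ((hs z).trans e)

end RealBibundle

/-- A Real generalized homomorphism from `Γ` to `G`. -/
structure RealGenHom (Γ G : RealGroupoid.{u}) extends RealBibundle Γ G where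
  isPrincipal : toRealBibundle.IsPrincipal
  isLocallyTrivial : toRealBibundle.IsLocallyTrivial

/-- Isomorphisms of Real generalized homomorphisms. -/
structure RealGenHom.Iso {Γ G : RealGroupoid.{u}} (Z Z' : RealGenHom Γ G) where
  f : Z.Z ≃ₜ Z'.Z
  rng_f : ∀ z, Z'.rng (f z) = Z.rng z
  src_f : ∀ z, Z'.src (f z) = Z.src z
  τ_f : ∀ z, f (Z.τ z) = Z'.τ (f z)
  f_lact : ∀ γ z (e : Γ.s γ = Z.rng z), f (Z.lact γ z e) = Z'.lact γ (f z) (e.trans (rng_f z).symm)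
  f_ract : ∀ z g (e : Z.src z = G.r g), f (Z.ract z g e) = Z'.ract (f z) g ((src_f z).trans e)

namespace RealGenHom

/-- Isomorphism is an equivalence relation. -/
instance isoSetoid (Γ G : RealGroupoid.{u}) : Setoid (RealGenHom Γ G) where
  r Z Z' := Nonempty (Iso Z Z')
  iseqv :=
    { refl := fun Z => ⟨{
        f := Homeomorph.refl _
        rng_f := fun _ => rfl
        src_f := fun _ => rfl
        τ_f := fun _ => rfl
        f_lact := fun _ _ _ => rfl
        f_ract := fun _ _ _ => rfl }⟩
      symm := fun {Z Z'} ⟨i⟩ => ⟨{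
        f := i.f.symm
        rng_f := fun z => by rw [← i.rng_f, i.f.apply_symm_apply]
        src_f := fun z => by rw [← i.src_f, i.f.apply_symm_apply]
        τ_f := fun z => i.f.injective (by rw [i.τ_f]; simp)
        f_lact := fun γ z e => i.f.injective (by rw [i.f_lact]; simp)
        f_ract := fun z g e => i.f.injective (by rw [i.f_ract]; simp) }⟩
      trans := fun {Z Z' Z''} ⟨i⟩ ⟨j⟩ => ⟨{
        f := i.f.trans j.f
        rng_f := fun z => (j.rng_f _).trans (i.rng_f z)
        src_f := fun z => (j.src_f _).trans (i.src_f z)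
        τ_f := fun z => by simp [i.τ_f, j.τ_f]
        f_lact := fun γ z e => by simp [i.f_lact, j.f_lact]
        f_ract := fun z g e => by simp [i.f_ract, j.f_ract] }⟩ }

end RealGenHom

/-- The set `Hom_RG(Γ, G)` of isomorphism classes of Real generalized homomorphisms. -/
def HomRG (Γ G : RealGroupoid.{u}) : Type (u + 1) :=
  Quotient (RealGenHom.isoSetoid Γ G)

/-- The isomorphism class of a Real generalized homomorphism. -/
def HomRG.mk {Γ G : RealGroupoid.{u}} (Z : RealGenHom Γ G) : HomRG Γ G :=
  Quotient.mk _ Z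

namespace RealBibundle

variable {Γ G : RealGroupoid.{u}}

theorem ract_congr (Z : RealBibundle Γ G) {z z' : Z.Z} {g g' : G.Arr} (hz : z = z') (hg : g = g')
    (e : Z.src z = G.r g) (e' : Z.src z' = G.r g') : Z.ract z g e = Z.ract z' g' e' := by
  subst hz hg; rfl

/-- For a principal bundle, the unique arrow `g` with `z g = w` depends continuously on the pair
`(z, w)` of points in the same fibre. -/
theorem IsPrincipal.exists_div {Z : RealBibundle Γ G} (hZ : Z.IsPrincipal) :
    ∃ d : {q : Z.Z × Z.Z // Z.rng q.1 = Z.rng q.2} → G.Arr, Continuous d ∧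
      (∀ q, ∃ e : Z.src q.1.1 = G.r (d q), Z.ract q.1.1 (d q) e = q.1.2) ∧
      ∀ q g (e : Z.src q.1.1 = G.r g), Z.ract q.1.1 g e = q.1.2 → d q = g := by
  obtain ⟨h, hh⟩ := isHomeomorph_iff_exists_homeomorph.1 hZ.2
  have key : ∀ q, (h.symm q).1.1 = q.1.1 ∧
      Z.ract (h.symm q).1.1 (h.symm q).1.2 (h.symm q).2 = q.1.2 := by
    intro q
    have := h.apply_symm_apply q
    rw [hh] at this
    exact ⟨congrArg (fun q => q.1.1) this, congrArg (fun q => q.1.2) this⟩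
  refine ⟨fun q => (h.symm q).1.2, by fun_prop, fun q => ?_, fun q g e hq => ?_⟩
  · obtain ⟨h1, h2⟩ := key q
    refine ⟨h1 ▸ (h.symm q).2, ?_⟩
    rw [← h2]
    exact Z.ract_congr h1.symm rfl _ _
  · have : h.symm q = ⟨(q.1.1, g), e⟩ := by
      rw [h.symm_apply_eq, hh]
      exact Subtype.ext (Prod.ext rfl hq.symm)
    show (h.symm _).1.2 = g
    rw [this]

theorem IsPrincipal.isLocallyTrivial {Z : RealBibundle Γ G} (hZ : Z.IsPrincipal) :
    Z.IsLocallyTrivial := by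
  obtain ⟨d, hd, hd1, hd2⟩ := hZ.exists_div
  choose e he using hd1
  intro y
  obtain ⟨U, hU, hy, σ, hσ⟩ := hZ.1 y
  have hz : ∀ z : {z : Z.Z // Z.rng z ∈ U}, Z.rng (σ ⟨_, z.2⟩) = Z.rng z.1 := fun z => hσ _
  have hs : ∀ z : {z : Z.Z // Z.rng z ∈ U}, G.s (d ⟨(σ ⟨_, z.2⟩, z.1), hz z⟩) = Z.src z.1 := by
    intro z
    rw [← Z.src_ract _ _ (e ⟨(σ ⟨_, z.2⟩, z.1), hz z⟩), he]
  refine ⟨U, hU, hy, ⟨fun u => Z.src (σ u), Z.continuous_src.comp σ.continuous⟩,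
    { toFun := fun z => ⟨(⟨_, z.2⟩, d ⟨(σ ⟨_, z.2⟩, z.1), hz z⟩), e ⟨(σ ⟨_, z.2⟩, z.1), hz z⟩⟩
      invFun := fun p => ⟨Z.ract (σ p.1.1) p.1.2 p.2, by
        rw [Z.rng_ract, hσ]; exact p.1.1.2⟩
      left_inv := fun z => Subtype.ext (he ⟨(σ ⟨_, z.2⟩, z.1), hz z⟩)
      right_inv := ?_
      continuous_toFun := ?_
      continuous_invFun := ?_ }, hs, fun _ => rfl, fun z g hg => ?_⟩
  · rintro ⟨⟨u, g⟩, hg⟩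
    have hg' : Z.src (σ u) = G.r g := hg
    have h0 : Z.rng (Z.ract (σ u) g hg') = u := by rw [Z.rng_ract, hσ]
    have h1 : (⟨Z.rng (Z.ract (σ u) g hg'), h0 ▸ u.2⟩ : U) = u := Subtype.ext h0
    refine Subtype.ext (Prod.ext h1 ?_)
    refine hd2 _ g ((congrArg (fun u => Z.src (σ u)) h1).trans hg') ?_
    exact Z.ract_congr (congrArg σ h1) rfl _ _
  · have := Z.continuous_rng
    fun_prop
  · exact (Z.continuous_ract.comp (f := fun p : {p : U × G.Arr // Z.src (σ p.1) = G.r p.2} =>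
      (⟨(σ p.1.1, p.1.2), p.2⟩ : {p : Z.Z × G.Arr // Z.src p.1 = G.r p.2})) (by fun_prop)).subtype_mk _
  · have h0 : Z.rng (Z.ract z.1 g hg) ∈ U := by rw [Z.rng_ract]; exact z.2
    have h1 : (⟨Z.rng (Z.ract z.1 g hg), h0⟩ : U) = ⟨_, z.2⟩ := Subtype.ext (Z.rng_ract _ _ _)
    have h2 := e ⟨(σ ⟨_, z.2⟩, z.1), hz z⟩
    refine hd2 _ _ (((congrArg (fun u => Z.src (σ u)) h1).trans h2).trans (G.r_mul _ _ _).symm) ?_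
    refine (Z.ract_congr (congrArg σ h1) rfl _ (h2.trans (G.r_mul _ _ _).symm)).trans ?_
    rw [Z.ract_mul _ _ _ h2]
    exact Z.ract_congr (he ⟨(σ ⟨_, z.2⟩, z.1), hz z⟩) rfl _ _

end RealBibundle

namespace RealBibundle

open RealGroupoid (ofGroup)

variable {G : RealGroupoid.{u}} {S : Type u}

section Group

variable [Group S] [TopologicalSpace S] [RealGroup S]

/-- The right action of a Real group on a bundle whose structure groupoid is that group. -/
def act (Z : RealBibundle G (ofGroup S)) (z : Z.Z) (t : S) : Z.Z :=
  Z.ract z t rfl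

variable (Z : RealBibundle G (ofGroup S))

theorem act_one (z : Z.Z) : Z.act z 1 = z := Z.ract_unit z

theorem act_act (z : Z.Z) (t t' : S) : Z.act (Z.act z t) t' = Z.act z (t * t') :=
  (Z.ract_mul z t t' rfl rfl).symm

theorem rng_act (z : Z.Z) (t : S) : Z.rng (Z.act z t) = Z.rng z := Z.rng_ract z t rfl

theorem τ_act (z : Z.Z) (t : S) : Z.τ (Z.act z t) = Z.act (Z.τ z) (RealGroup.conj t) :=
  Z.τ_ract z t rfl

theorem lact_act (γ : G.Arr) (z : Z.Z) (t : S) (e : G.s γ = Z.rng (Z.act z t))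
    (e' : G.s γ = Z.rng z) : Z.lact γ (Z.act z t) e = Z.act (Z.lact γ z e') t :=
  Z.lact_ract γ z t e' rfl

theorem continuous_act : Continuous fun p : Z.Z × S => Z.act p.1 p.2 :=
  Z.continuous_ract.comp (f := fun p : Z.Z × S =>
    (⟨p, rfl⟩ : {p : Z.Z × (ofGroup S).Arr // Z.src p.1 = (ofGroup S).r p.2}))
    (continuous_id.subtype_mk _)

theorem IsPrincipal.exists_divS {Z : RealBibundle G (ofGroup S)} (hZ : Z.IsPrincipal) :
    ∃ d : {q : Z.Z × Z.Z // Z.rng q.1 = Z.rng q.2} → S, Continuous d ∧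
      (∀ q, Z.act q.1.1 (d q) = q.1.2) ∧ ∀ q t, Z.act q.1.1 t = q.1.2 → d q = t := by
  obtain ⟨d, h1, h2, h3⟩ := hZ.exists_div
  exact ⟨d, h1, fun q => (h2 q).choose_spec, fun q t h => h3 q t rfl h⟩

/-- A bundle with a continuous division map is principal as soon as it is locally split. -/
theorem isPrincipal_of_div
    (hs : ∀ y : G.Obj, ∃ U : Set G.Obj, IsOpen U ∧ y ∈ U ∧
      ∃ σ : C(U, Z.Z), ∀ u, Z.rng (σ u) = u)
    (d : {q : Z.Z × Z.Z // Z.rng q.1 = Z.rng q.2} → S) (hd : Continuous d)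
    (h1 : ∀ q, Z.act q.1.1 (d q) = q.1.2) (h2 : ∀ q t, Z.act q.1.1 t = q.1.2 → d q = t) :
    Z.IsPrincipal := by
  refine ⟨hs, isHomeomorph_iff_exists_homeomorph.2 ⟨
    { toFun := Z.shear
      invFun := fun q => ⟨(q.1.1, d q), rfl⟩
      left_inv := fun p => Subtype.ext (Prod.ext rfl (h2 _ _ rfl))
      right_inv := fun q => Subtype.ext (Prod.ext rfl (h1 q))
      continuous_toFun := ?_
      continuous_invFun := ?_ }, rfl⟩⟩
  · exact ((continuous_fst.comp continuous_subtype_val).prodMk Z.continuous_ract).subtype_mk _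
  · exact ((continuous_fst.comp continuous_subtype_val).prodMk hd).subtype_mk _

end Group

section CommGroup

variable [CommGroup S] [TopologicalSpace S] [RealGroup S]

/-- The fibred product `Z ×_X Z'`. -/
abbrev FibProd (Z Z' : RealBibundle G (ofGroup S)) : Type u :=
  {p : Z.Z × Z'.Z // Z.rng p.1 = Z'.rng p.2}

/-- The relation `(z, z') ∼ (z t⁻¹, z' t)` on `Z ×_X Z'`. -/
def sumSetoid (Z Z' : RealBibundle G (ofGroup S)) : Setoid (FibProd Z Z') where
  r p q := ∃ t : S, q.1.1 = Z.act p.1.1 t⁻¹ ∧ q.1.2 = Z'.act p.1.2 t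
  iseqv :=
    { refl := fun p => ⟨1, by rw [inv_one, act_one], by rw [act_one]⟩
      symm := fun {p q} ⟨t, h1, h2⟩ => ⟨t⁻¹, by rw [h1, act_act]; simp [act_one],
        by rw [h2, act_act]; simp [act_one]⟩
      trans := fun {p q w} ⟨t, h1, h2⟩ ⟨t', h3, h4⟩ => ⟨t * t',
        by rw [h3, h1, act_act, mul_inv], by rw [h4, h2, act_act]⟩ }

/-- The quotient space `Z ×_X Z' / ∼`. -/
abbrev SumSpace (Z Z' : RealBibundle G (ofGroup S)) : Type u :=
  Quotient (sumSetoid Z Z')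

variable (Z Z' : RealBibundle G (ofGroup S))

/-- The class `[z, z']`. -/
def sumMk (p : FibProd Z Z') : SumSpace Z Z' := Quotient.mk _ p

variable {Z Z'}

theorem sumMk_eq {p q : FibProd Z Z'} (t : S) (h1 : q.1.1 = Z.act p.1.1 t⁻¹)
    (h2 : q.1.2 = Z'.act p.1.2 t) : sumMk Z Z' p = sumMk Z Z' q :=
  Quotient.sound ⟨t, h1, h2⟩

theorem sumMk_eq_iff {p q : FibProd Z Z'} : sumMk Z Z' p = sumMk Z Z' q ↔
    ∃ t : S, q.1.1 = Z.act p.1.1 t⁻¹ ∧ q.1.2 = Z'.act p.1.2 t :=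
  Quotient.eq

theorem sumMk_ind {C : SumSpace Z Z' → Prop} (h : ∀ p, C (sumMk Z Z' p)) (q) : C q :=
  Quotient.ind h q

variable (Z Z')

theorem isOpenQuotientMap_sumMk : IsOpenQuotientMap (sumMk Z Z') := by
  refine ⟨Quotient.mk_surjective, continuous_quotient_mk', fun O hO => ?_⟩
  rw [isOpen_coinduced]
  let T : S → FibProd Z Z' → FibProd Z Z' := fun t p =>
    ⟨(Z.act p.1.1 t⁻¹, Z'.act p.1.2 t), by rw [rng_act, rng_act]; exact p.2⟩
  have hT : ∀ t, Continuous (T t) := fun t => by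
    have h1 := Z.continuous_act
    have h2 := Z'.continuous_act
    refine Continuous.subtype_mk (Continuous.prodMk ?_ ?_) _
    · exact h1.comp (f := fun p : FibProd Z Z' => (p.1.1, t⁻¹)) (by fun_prop)
    · exact h2.comp (f := fun p : FibProd Z Z' => (p.1.2, t)) (by fun_prop)
  have : Quotient.mk (sumSetoid Z Z') ⁻¹' (sumMk Z Z' '' O) = ⋃ t, T t ⁻¹' O := by
    ext p
    simp only [mem_preimage, mem_image, mem_iUnion]
    constructor
    · rintro ⟨q, hq, hqp⟩
      obtain ⟨t, h1, h2⟩ := sumMk_eq_iff.1 hqp.symm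
      refine ⟨t, ?_⟩
      rwa [show T t p = q from Subtype.ext (Prod.ext h1.symm h2.symm)]
    · rintro ⟨t, ht⟩
      exact ⟨_, ht, (sumMk_eq t rfl rfl).symm⟩
  exact this ▸ isOpen_iUnion fun t => hO.preimage (hT t)

/-- The projection of `Z ×_X Z' / ∼` to `X`. -/
def sumRng : SumSpace Z Z' → G.Obj :=
  Quotient.lift (fun p => Z.rng p.1.1) fun p q ⟨t, h1, _⟩ => by
    show Z.rng p.1.1 = Z.rng q.1.1
    rw [h1, rng_act]

/-- The Real structure `[z, z'] ↦ [τ z, τ' z']`. -/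
def sumτ : SumSpace Z Z' → SumSpace Z Z' :=
  Quotient.lift (fun p => sumMk Z Z' ⟨(Z.τ p.1.1, Z'.τ p.1.2), by
      rw [Z.rng_τ, Z'.rng_τ, p.2]⟩)
    fun p q ⟨t, h1, h2⟩ => sumMk_eq (RealGroup.conj t)
      (by show Z.τ q.1.1 = _; rw [h1, τ_act, map_inv]) (by show Z'.τ q.1.2 = _; rw [h2, τ_act])

/-- The right action `[z, z'] t = [z, z' t]`. -/
def sumAct (t : S) : SumSpace Z Z' → SumSpace Z Z' :=
  Quotient.lift (fun p => sumMk Z Z' ⟨(p.1.1, Z'.act p.1.2 t), by rw [rng_act]; exact p.2⟩)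
    fun p q ⟨t', h1, h2⟩ => sumMk_eq t' h1 (by
      show Z'.act q.1.2 t = Z'.act (Z'.act p.1.2 t) t'
      rw [h2, act_act, act_act, mul_comm])

theorem sumRng_sumAct (t : S) (q : SumSpace Z Z') :
    sumRng Z Z' (sumAct Z Z' t q) = sumRng Z Z' q := by
  induction q using sumMk_ind with | _ p
  rfl

/-- The left action `γ [z, z'] = [γ z, γ z']`. -/
def sumLact (γ : G.Arr) (q : SumSpace Z Z') : G.s γ = sumRng Z Z' q → SumSpace Z Z' :=
  Quotient.hrecOn (motive := fun q => G.s γ = sumRng Z Z' q → SumSpace Z Z') q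
    (fun p e => sumMk Z Z' ⟨(Z.lact γ p.1.1 e, Z'.lact γ p.1.2 (Eq.trans e p.2)),
      (Z.rng_lact _ _ _).trans (Z'.rng_lact _ _ _).symm⟩)
    fun p q h => by
      have hpq : sumRng Z Z' (Quotient.mk _ p) = sumRng Z Z' (Quotient.mk _ q) :=
        congrArg _ (Quotient.sound h)
      obtain ⟨t, h1, h2⟩ := h
      refine Function.hfunext (by rw [hpq]) fun e e' _ => heq_of_eq (sumMk_eq t ?_ ?_)
      · have e1 : G.s γ = Z.rng q.1.1 := e'
        show Z.lact γ q.1.1 e1 = _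
        generalize q.1.1 = z at h1 e1
        subst h1
        exact lact_act _ _ _ _ _ _
      · have e1 : G.s γ = Z'.rng q.1.2 := e'.trans q.2
        show Z'.lact γ q.1.2 e1 = _
        generalize q.1.2 = z at h2 e1
        subst h2
        exact lact_act _ _ _ _ _ _

variable {Z Z'} in
theorem sum_exists_div (hZ : Z.IsPrincipal) (hZ' : Z'.IsPrincipal) :
    ∃ d : {q : SumSpace Z Z' × SumSpace Z Z' // sumRng Z Z' q.1 = sumRng Z Z' q.2} → S,
      Continuous d ∧ (∀ q, sumAct Z Z' (d q) q.1.1 = q.1.2) ∧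
      ∀ q t, sumAct Z Z' t q.1.1 = q.1.2 → d q = t := by
  obtain ⟨d, hd, hd1, hd2⟩ := hZ.exists_divS
  obtain ⟨d', hd', hd1', hd2'⟩ := hZ'.exists_divS
  have hq := (isOpenQuotientMap_sumMk Z Z').prodMap (isOpenQuotientMap_sumMk Z Z')
  have hq' := hq.restrictPreimage {q | sumRng Z Z' q.1 = sumRng Z Z' q.2}
  let D : (Prod.map (sumMk Z Z') (sumMk Z Z') ⁻¹'
      {q | sumRng Z Z' q.1 = sumRng Z Z' q.2}) → S := fun p =>
    d ⟨(p.1.1.1.1, p.1.2.1.1), p.2⟩ *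
      d' ⟨(p.1.1.1.2, p.1.2.1.2), (p.1.1.2.symm.trans p.2).trans p.1.2.2⟩
  have hD : Continuous D := by
    refine Continuous.mul ?_ ?_
    · exact hd.comp (Continuous.subtype_mk (by fun_prop) _)
    · exact hd'.comp (Continuous.subtype_mk (by fun_prop) _)
  have hDS : ∀ p q (h : sumRng Z Z' (sumMk Z Z' p) = sumRng Z Z' (sumMk Z Z' q)) t,
      D ⟨(p, q), h⟩ = t ↔
      sumAct Z Z' t (sumMk Z Z' p) = sumMk Z Z' q := by
    intro p q h t
    have h : Z.rng p.1.1 = Z.rng q.1.1 := h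
    have h' : Z'.rng p.1.2 = Z'.rng q.1.2 := (p.2.symm.trans h).trans q.2
    have a1 : Z.act p.1.1 (d ⟨(p.1.1, q.1.1), h⟩) = q.1.1 := hd1 ⟨(p.1.1, q.1.1), h⟩
    have a2 : Z'.act p.1.2 (d' ⟨(p.1.2, q.1.2), h'⟩) = q.1.2 := hd1' ⟨(p.1.2, q.1.2), h'⟩
    show d ⟨(p.1.1, q.1.1), h⟩ * d' ⟨(p.1.2, q.1.2), h'⟩ = t ↔ _
    constructor
    · rintro rfl
      refine sumMk_eq (d ⟨(p.1.1, q.1.1), h⟩)⁻¹ ?_ ?_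
      · rw [inv_inv]; exact a1.symm
      · show _ = Z'.act (Z'.act p.1.2 _) _
        rw [act_act, mul_right_comm, mul_inv_cancel, one_mul]; exact a2.symm
    · intro hp
      obtain ⟨w, h1, h2⟩ := sumMk_eq_iff.1 hp
      rw [hd2 ⟨(p.1.1, q.1.1), h⟩ _ h1.symm,
        hd2' ⟨(p.1.2, q.1.2), h'⟩ (t * w) (by rw [← act_act]; exact h2.symm)]
      rw [mul_left_comm, inv_mul_cancel, mul_one]
  have hex : ∀ q : {q : SumSpace Z Z' × SumSpace Z Z' // sumRng Z Z' q.1 = sumRng Z Z' q.2},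
      ∃ t, sumAct Z Z' t q.1.1 = q.1.2 ∧ ∀ t', sumAct Z Z' t' q.1.1 = q.1.2 → t = t' := by
    rintro ⟨⟨x, y⟩, h⟩
    induction x using sumMk_ind with | _ p
    induction y using sumMk_ind with | _ q
    exact ⟨_, (hDS p q h _).1 rfl, fun t' h' => (hDS p q h _).2 h'⟩
  choose e he he' using hex
  refine ⟨e, ?_, he, he'⟩
  rw [hq'.isQuotientMap.continuous_iff]
  convert hD using 1
  funext ⟨⟨p, q⟩, h⟩
  exact he' _ _ ((hDS p q h _).1 rfl)

variable {Z Z'} in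
theorem sum_exists_section (hZ : Z.IsPrincipal) (hZ' : Z'.IsPrincipal) (y : G.Obj) :
    ∃ U : Set G.Obj, IsOpen U ∧ y ∈ U ∧
      ∃ σ : C(U, SumSpace Z Z'), ∀ u, sumRng Z Z' (σ u) = u := by
  obtain ⟨U, hU, hy, σ, hσ⟩ := hZ.1 y
  obtain ⟨V, hV, hy', σ', hσ'⟩ := hZ'.1 y
  refine ⟨U ∩ V, hU.inter hV, ⟨hy, hy'⟩, ⟨fun u => sumMk Z Z'
    ⟨(σ ⟨u, u.2.1⟩, σ' ⟨u, u.2.2⟩), by rw [hσ, hσ']⟩, ?_⟩, fun u => hσ ⟨u, u.2.1⟩⟩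
  exact (isOpenQuotientMap_sumMk Z Z').continuous.comp (Continuous.subtype_mk (by fun_prop) _)

theorem continuous_sumRng : Continuous (sumRng Z Z') :=
  (isOpenQuotientMap_sumMk Z Z').continuous_comp_iff.1
    (Z.continuous_rng.comp (by fun_prop : Continuous fun p : FibProd Z Z' => p.1.1))

theorem continuous_sumAct :
    Continuous fun p : SumSpace Z Z' × S => sumAct Z Z' p.2 p.1 := by
  rw [← ((isOpenQuotientMap_sumMk Z Z').prodMap (.id (X := S))).continuous_comp_iff]
  refine (isOpenQuotientMap_sumMk Z Z').continuous.comp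
    (f := fun p : FibProd Z Z' × S => (⟨(p.1.1.1, Z'.act p.1.1.2 p.2), _⟩ : FibProd Z Z')) ?_
  refine Continuous.subtype_mk (Continuous.prodMk (by fun_prop) ?_) _
  exact Z'.continuous_act.comp (by fun_prop : Continuous fun p : FibProd Z Z' × S => (p.1.1.2, p.2))

variable {Z Z'} in
theorem isOpenMap_sumRng (hZ : Z.IsPrincipal) (hZ' : Z'.IsPrincipal) :
    IsOpenMap (sumRng Z Z') := by
  intro O hO
  rw [isOpen_iff_mem_nhds]
  rintro _ ⟨q, hq, rfl⟩
  obtain ⟨U, hU, hy, σ, hσ⟩ := sum_exists_section hZ hZ' (sumRng Z Z' q)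
  obtain ⟨d, -, hd, -⟩ := sum_exists_div hZ hZ'
  have h0 : sumRng Z Z' (σ ⟨_, hy⟩) = sumRng Z Z' q := hσ _
  have ht := hd ⟨(σ ⟨_, hy⟩, q), h0⟩
  generalize d ⟨(σ ⟨_, hy⟩, q), h0⟩ = t at ht
  have hc : Continuous fun u : U => sumAct Z Z' t (σ u) :=
    (continuous_sumAct Z Z').comp (by fun_prop : Continuous fun u : U => (σ u, t))
  have hm : (fun u : U => sumAct Z Z' t (σ u)) ⁻¹' O ∈ 𝓝 (⟨_, hy⟩ : U) :=
    (hO.preimage hc).mem_nhds (by show sumAct Z Z' t _ ∈ O; rw [ht]; exact hq)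
  refine Filter.mem_of_superset (hU.isOpenMap_subtype_val.image_mem_nhds hm) ?_
  rintro _ ⟨u, hu, rfl⟩
  refine ⟨_, hu, ?_⟩
  exact (sumRng_sumAct Z Z' t _).trans (hσ u)

instance locallyCompactSpace_sumSpace : LocallyCompactSpace (SumSpace Z Z') := by
  have h1 : IsClosed {p : Z.Z × Z'.Z | Z.rng p.1 = Z'.rng p.2} :=
    isClosed_eq (Z.continuous_rng.comp continuous_fst) (Z'.continuous_rng.comp continuous_snd)
  have : LocallyCompactSpace (FibProd Z Z') := h1.isClosedEmbedding_subtypeVal.locallyCompactSpace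
  exact (isOpenQuotientMap_sumMk Z Z').locallyCompactSpace

variable {Z Z'} in
theorem t2Space_sumSpace (hZ : Z.IsPrincipal) (hZ' : Z'.IsPrincipal) :
    T2Space (SumSpace Z Z') := by
  obtain ⟨d, hd, hd1, hd2⟩ := sum_exists_div hZ hZ'
  have hc : IsClosed {q : SumSpace Z Z' × SumSpace Z Z' | sumRng Z Z' q.1 = sumRng Z Z' q.2} :=
    isClosed_eq ((continuous_sumRng Z Z').comp continuous_fst)
      ((continuous_sumRng Z Z').comp continuous_snd)
  have h2 := hc.isClosedEmbedding_subtypeVal.isClosedMap _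
    ((isClosed_singleton (x := (1 : S))).preimage hd)
  rw [t2_iff_isClosed_diagonal]
  convert h2
  have one : ∀ q, sumAct Z Z' 1 q = q := by
    intro q
    induction q using sumMk_ind with | _ p
    exact congrArg (sumMk Z Z') (Subtype.ext (Prod.ext rfl (act_one _ _)))
  ext ⟨x, y⟩
  simp only [mem_diagonal_iff, mem_image, mem_preimage, mem_singleton_iff, Subtype.exists,
    exists_and_right, exists_eq_right]
  constructor
  · rintro rfl
    exact ⟨rfl, hd2 _ _ (one x)⟩
  · rintro ⟨h, hxy⟩
    have := hd1 ⟨(x, y), h⟩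
    rw [hxy, one] at this
    exact this

theorem continuous_sumLact :
    Continuous fun p : {p : G.Arr × SumSpace Z Z' // G.s p.1 = sumRng Z Z' p.2} =>
      sumLact Z Z' p.1.1 p.1.2 p.2 := by
  have hq := ((IsOpenQuotientMap.id (X := G.Arr)).prodMap (isOpenQuotientMap_sumMk Z Z'))
  have hq' := hq.restrictPreimage {p : G.Arr × SumSpace Z Z' | G.s p.1 = sumRng Z Z' p.2}
  refine hq'.continuous_comp_iff.1 ?_
  have c1 := Z.continuous_lact
  have c2 := Z'.continuous_lact
  refine (isOpenQuotientMap_sumMk Z Z').continuous.comp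
    (f := fun p : (Prod.map id (sumMk Z Z') ⁻¹'
      {p : G.Arr × SumSpace Z Z' | G.s p.1 = sumRng Z Z' p.2}) =>
      (⟨(Z.lact p.1.1 p.1.2.1.1 p.2, Z'.lact p.1.1 p.1.2.1.2 (Eq.trans p.2 p.1.2.2)), _⟩ :
        FibProd Z Z')) ?_
  refine Continuous.subtype_mk (Continuous.prodMk ?_ ?_) _
  · refine c1.comp (f := fun p : (Prod.map id (sumMk Z Z') ⁻¹'
      {p : G.Arr × SumSpace Z Z' | G.s p.1 = sumRng Z Z' p.2}) =>
      (⟨(p.1.1, p.1.2.1.1), p.2⟩ : {p : G.Arr × Z.Z // G.s p.1 = Z.rng p.2})) ?_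
    exact Continuous.subtype_mk (by fun_prop) _
  · refine c2.comp (f := fun p : (Prod.map id (sumMk Z Z') ⁻¹'
      {p : G.Arr × SumSpace Z Z' | G.s p.1 = sumRng Z Z' p.2}) =>
      (⟨(p.1.1, p.1.2.1.2), Eq.trans p.2 p.1.2.2⟩ :
        {p : G.Arr × Z'.Z // G.s p.1 = Z'.rng p.2})) ?_
    exact Continuous.subtype_mk (by fun_prop) _

theorem continuous_sumτ : Continuous (sumτ Z Z') := by
  refine (isOpenQuotientMap_sumMk Z Z').continuous_comp_iff.1 ?_
  have c1 := Z.continuous_τ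
  have c2 := Z'.continuous_τ
  exact (isOpenQuotientMap_sumMk Z Z').continuous.comp
    (Continuous.subtype_mk (f := fun p : FibProd Z Z' => (Z.τ p.1.1, Z'.τ p.1.2)) (by fun_prop) _)

end CommGroup

end RealBibundle

namespace RealGenHom

open RealBibundle
open RealGroupoid (ofGroup)

variable {G : RealGroupoid.{u}} {S : Type u} [CommGroup S] [TopologicalSpace S] [RealGroup S]

/-- The underlying bibundle of the sum `Z ×_X Z' / ∼`. -/
def sumBibundle (Z Z' : RealGenHom G (ofGroup S)) : RealBibundle G (ofGroup S) where
  Z := SumSpace Z.toRealBibundle Z'.toRealBibundle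
  t2Z := t2Space_sumSpace Z.isPrincipal Z'.isPrincipal
  τ := sumτ _ _
  continuous_τ := continuous_sumτ _ _
  τ_τ := sumMk_ind fun p => congrArg (sumMk _ _)
    (Subtype.ext (Prod.ext (Z.τ_τ _) (Z'.τ_τ _)))
  rng := sumRng _ _
  src _ := PUnit.unit
  continuous_rng := continuous_sumRng _ _
  isOpenMap_rng := isOpenMap_sumRng Z.isPrincipal Z'.isPrincipal
  surjective_rng y := by
    obtain ⟨U, -, hy, σ, hσ⟩ := sum_exists_section Z.isPrincipal Z'.isPrincipal y
    exact ⟨σ ⟨y, hy⟩, hσ _⟩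
  continuous_src := continuous_const
  isOpenMap_src := fun O _ => isOpen_discrete (α := PUnit) _
  rng_τ := sumMk_ind fun p => Z.rng_τ _
  src_τ _ := rfl
  lact := sumLact _ _
  ract q t _ := sumAct _ _ t q
  continuous_lact := continuous_sumLact _ _
  continuous_ract := (continuous_sumAct _ _).comp continuous_subtype_val
  rng_lact γ := sumMk_ind fun p e => Z.rng_lact γ p.1.1 e
  src_lact _ _ _ := rfl
  src_ract _ _ _ := rfl
  rng_ract q t _ := sumRng_sumAct (S := S) _ _ t q
  unit_lact := sumMk_ind fun p => congrArg (sumMk _ _) (Subtype.ext (Prod.ext (Z.unit_lact _)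
    (by
      have := Z'.unit_lact p.1.2
      simp only [← p.2] at this
      exact this)))
  ract_unit := sumMk_ind fun p => congrArg (sumMk _ _) (Subtype.ext (Prod.ext rfl
    (act_one _ _)))
  mul_lact γ γ' := sumMk_ind fun p e e' => congrArg (sumMk _ _) (Subtype.ext (Prod.ext
    (Z.mul_lact _ _ _ e e') (Z'.mul_lact _ _ _ e _)))
  ract_mul q t t' _ _ := by
    induction q using sumMk_ind with | _ p
    exact congrArg (sumMk _ _) (Subtype.ext (Prod.ext rfl (act_act _ _ _ _).symm))
  lact_ract γ := sumMk_ind fun p t e _ => congrArg (sumMk _ _) (Subtype.ext (Prod.ext rfl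
    (lact_act _ _ _ _ _ _)))
  τ_lact γ := sumMk_ind fun p e => congrArg (sumMk _ _) (Subtype.ext (Prod.ext
    (Z.τ_lact _ _ _) (Z'.τ_lact _ _ _)))
  τ_ract := sumMk_ind fun p t _ => congrArg (sumMk _ _) (Subtype.ext (Prod.ext rfl
    (τ_act _ _ _)))

/-- The sum `(Z, τ) + (Z', τ') = (Z ×_X Z' / ∼, τ × τ')`. -/
def sum (Z Z' : RealGenHom G (ofGroup S)) : RealGenHom G (ofGroup S) :=
  have h : (sumBibundle Z Z').IsPrincipal := by
    obtain ⟨d, h1, h2, h3⟩ := sum_exists_div Z.isPrincipal Z'.isPrincipal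
    exact isPrincipal_of_div _ (sum_exists_section Z.isPrincipal Z'.isPrincipal) d h1 h2 h3
  { toRealBibundle := sumBibundle Z Z'
    isPrincipal := h
    isLocallyTrivial := h.isLocallyTrivial }

/-- The underlying bibundle of the inverse: `Z` with the right action `z • t = z t⁻¹`. -/
def invBibundle (Z : RealGenHom G (ofGroup S)) : RealBibundle G (ofGroup S) where
  __ := Z.toRealBibundle
  ract z t _ := Z.act z t⁻¹
  continuous_ract := Z.continuous_act.comp
    (f := fun p : {p : Z.Z × S // Z.src p.1 = PUnit.unit} => (p.1.1, p.1.2⁻¹)) (by fun_prop)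
  src_ract _ _ _ := rfl
  rng_ract z t _ := Z.rng_act z (t : S)⁻¹
  ract_unit z := (congrArg (Z.act z) inv_one).trans (Z.act_one z)
  ract_mul z t t' _ _ := (congrArg (Z.act z) (_root_.mul_inv (α := S) t t')).trans
    (Z.act_act z (t : S)⁻¹ (t' : S)⁻¹).symm
  lact_ract γ z t e _ := Z.lact_act γ z (t : S)⁻¹ _ e
  τ_ract := fun z (t : S) _ => (Z.τ_act z t⁻¹).trans
    (congrArg (Z.act (Z.τ z)) (map_inv (RealGroup.conj (S := S)) t))

/-- The inverse `(Z⁻¹, τ)`. -/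
def inv (Z : RealGenHom G (ofGroup S)) : RealGenHom G (ofGroup S) :=
  have h : (invBibundle Z).IsPrincipal := by
    obtain ⟨d, h1, h2, h3⟩ := Z.isPrincipal.exists_divS
    refine isPrincipal_of_div _ Z.isPrincipal.1 (fun q => (d q)⁻¹) h1.inv (fun q => ?_)
      (fun q t h => ?_)
    · exact (congrArg (Z.act _) (inv_inv _)).trans (h2 q)
    · exact (congrArg _ (h3 q t⁻¹ h)).trans (inv_inv t)
  { toRealBibundle := invBibundle Z
    isPrincipal := h
    isLocallyTrivial := h.isLocallyTrivial }

end RealGenHom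

namespace RealGroupoid

/-- The space `G_n` of strict morphisms from the pair groupoid `[n] × [n] ⇉ [n]` to `G`. -/
@[ext]
structure Nerve (G : RealGroupoid.{u}) (n : ℕ) where
  obj : Fin (n + 1) → G.Obj
  arr : Fin (n + 1) → Fin (n + 1) → G.Arr
  r_arr : ∀ i j, G.r (arr i j) = obj i
  s_arr : ∀ i j, G.s (arr i j) = obj j
  arr_self : ∀ i, arr i i = G.unit (obj i)
  arr_mul : ∀ i j k, G.mul (arr i j) (arr j k) ((s_arr i j).trans (r_arr j k).symm) = arr i k

namespace Nerve

variable {G : RealGroupoid.{u}} {m n : ℕ}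

instance : TopologicalSpace (Nerve G n) :=
  TopologicalSpace.induced (fun x => (x.obj, x.arr)) inferInstance

theorem continuous_pair : Continuous fun x : Nerve G n => (x.obj, x.arr) :=
  continuous_induced_dom

/-- The Real structure `ρ_n`. -/
def ρ (x : Nerve G n) : Nerve G n where
  obj i := G.ρ₀ (x.obj i)
  arr i j := G.ρ (x.arr i j)
  r_arr i j := by rw [G.r_ρ, x.r_arr]
  s_arr i j := by rw [G.s_ρ, x.s_arr]
  arr_self i := by rw [x.arr_self, G.ρ_unit]
  arr_mul i j k := (G.ρ_mul _ _ ((x.s_arr i j).trans (x.r_arr j k).symm)).symm.trans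
    (congrArg G.ρ (x.arr_mul i j k))

/-- The map `G_n → G_m` induced by a map `[m] → [n]`. -/
def face (f : Fin (m + 1) → Fin (n + 1)) (x : Nerve G n) : Nerve G m where
  obj i := x.obj (f i)
  arr i j := x.arr (f i) (f j)
  r_arr _ _ := x.r_arr _ _
  s_arr _ _ := x.s_arr _ _
  arr_self _ := x.arr_self _
  arr_mul _ _ _ := x.arr_mul _ _ _

theorem ρ_ρ (x : Nerve G n) : ρ (ρ x) = x :=
  Nerve.ext (funext fun _ => G.ρ₀_ρ₀ _) (funext fun _ => funext fun _ => G.ρ_ρ _)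

theorem face_ρ (f : Fin (m + 1) → Fin (n + 1)) (x : Nerve G n) : face f (ρ x) = ρ (face f x) := rfl

theorem continuous_face (f : Fin (m + 1) → Fin (n + 1)) : Continuous (face (G := G) f) := by
  have h := continuous_pair (G := G) (n := n)
  have h1 := continuous_fst.comp h
  have h2 := continuous_snd.comp h
  refine continuous_induced_rng.2 (Continuous.prodMk ?_ ?_)
  · exact continuous_pi fun i => (continuous_apply (f i)).comp h1
  · exact continuous_pi fun i => continuous_pi fun j =>
      (continuous_apply (f j)).comp ((continuous_apply (f i)).comp h2)

end Nerve

end RealGroupoid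

open RealGroupoid (Nerve)

/-- A Real open cover of `(X, ρ)`: an open cover indexed by a set with an involution
`j ↦ j̄` such that `U_j̄ = ρ(U_j)`. -/
structure RealCover (X : Type u) [TopologicalSpace X] (ρ : X → X) where
  J : Type u
  bar : J → J
  bar_bar : ∀ j, bar (bar j) = j
  U : J → Set X
  isOpen_U : ∀ j, IsOpen (U j)
  exists_mem : ∀ x, ∃ j, x ∈ U j
  U_bar : ∀ j, U (bar j) = ρ '' U j

theorem RealCover.mem_bar {X : Type u} [TopologicalSpace X] {ρ : X → X} (V : RealCover X ρ) {j : V.J}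
    {x : X} (hx : x ∈ V.U j) : ρ x ∈ V.U (V.bar j) := by
  rw [V.U_bar]; exact mem_image_of_mem _ hx

/-- A Real open cover of `G_•`: a sequence of Real open covers of the spaces `G_n`. -/
abbrev NerveCover (G : RealGroupoid.{u}) : Type (u + 1) :=
  ∀ n : ℕ, RealCover (Nerve G n) Nerve.ρ

/-- A pre-simplicial Real open cover of `G_•`: strictly increasing maps `f : [m] → [n]` act on the
index sets, compatibly with the involutions, and `f̃(U^n_j) ⊆ U^m_{f̃(j)}`. -/
structure PreSimplicialCover (G : RealGroupoid.{u}) where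
  cov : NerveCover G
  face : ∀ {m n : ℕ}, (Fin (m + 1) ↪o Fin (n + 1)) → (cov n).J → (cov m).J
  face_id : ∀ {n : ℕ} (j : (cov n).J), face (RelEmbedding.refl _) j = j
  face_comp : ∀ {l m n : ℕ} (f : Fin (l + 1) ↪o Fin (m + 1)) (g : Fin (m + 1) ↪o Fin (n + 1))
    (j : (cov n).J), face (f.trans g) j = face f (face g j)
  face_bar : ∀ {m n : ℕ} (f : Fin (m + 1) ↪o Fin (n + 1)) (j : (cov n).J),
    face f ((cov n).bar j) = (cov m).bar (face f j)
  face_mem : ∀ {m n : ℕ} (f : Fin (m + 1) ↪o Fin (n + 1)) (j : (cov n).J), ∀ x ∈ (cov n).U j,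
    Nerve.face f x ∈ (cov m).U (face f j)

namespace PreSimplicialCover

variable {G : RealGroupoid.{u}} (V : PreSimplicialCover G) {S : Type u}

section Group

variable [Group S] [TopologicalSpace S] [RealGroup S]

/-- The group of Real `n`-cochains: families of continuous maps `c_j : U^n_j → S` such that
`c_j̄(ρ_n(x))` is the conjugate of `c_j(x)`. -/
def CR (S : Type u) [Group S] [TopologicalSpace S] [RealGroup S] (n : ℕ) :
    Subgroup (∀ j : (V.cov n).J, C((V.cov n).U j, S)) where
  carrier := {c | ∀ j x (hx : x ∈ (V.cov n).U j),
    c ((V.cov n).bar j) ⟨Nerve.ρ x, (V.cov n).mem_bar hx⟩ = RealGroup.conj (c j ⟨x, hx⟩)}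
  mul_mem' := fun {a b} ha hb j x hx => by simp [ha j x hx, hb j x hx]
  one_mem' := fun j x hx => by simp
  inv_mem' := fun {a} ha j x hx => by simp [ha j x hx]

/-- The restriction map `f̃^* : Γ(U^m_{f̃(j)}, S) → Γ(U^n_j, S)`, applied to a member of a
family `c`. -/
def res {m n : ℕ} (c : ∀ j : (V.cov m).J, C((V.cov m).U j, S)) (f : Fin (m + 1) ↪o Fin (n + 1))
    (j : (V.cov n).J) : C((V.cov n).U j, S) :=
  (c (V.face f j)).comp ⟨fun x => ⟨Nerve.face f x.1, V.face_mem f j x.1 x.2⟩,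
    ((Nerve.continuous_face f).comp continuous_subtype_val).subtype_mk _⟩

/-- The map `ε_k : [n] → [n + 1]` that avoids `k`. -/
abbrev ε {n : ℕ} (k : Fin (n + 2)) : Fin (n + 1) ↪o Fin (n + 2) :=
  Fin.succAboveOrderEmb k

/-- Real `1`-cocycles: `ε₁^* c = ε₂^* c · ε₀^* c`, that is
`c_{j₀j₂}(g₁g₂) = c_{j₀j₁}(g₁) c_{j₁j₂}(g₂)`. -/
def ZR1 (S : Type u) [Group S] [TopologicalSpace S] [RealGroup S] : Type u :=
  {c : V.CR S 1 // ∀ j : (V.cov 2).J, V.res c.1 (ε 1) j = V.res c.1 (ε 2) j * V.res c.1 (ε 0) j}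

/-- Two `1`-cocycles are cohomologous if `c' = (ε₁^* φ)⁻¹ · c · ε₀^* φ` for a Real
`0`-cochain `φ`. -/
instance cohSetoid (S : Type u) [Group S] [TopologicalSpace S] [RealGroup S] :
    Setoid (V.ZR1 S) where
  r c c' := ∃ φ : V.CR S 0, ∀ j : (V.cov 1).J,
    c'.1.1 j = (V.res φ.1 (ε 1) j)⁻¹ * c.1.1 j * V.res φ.1 (ε 0) j
  iseqv :=
    { refl := fun c => ⟨1, fun j => by ext x; simp [res]⟩
      symm := fun {c c'} ⟨φ, h⟩ => ⟨φ⁻¹, fun j => by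
        ext x; simp [res, h]; group⟩
      trans := fun {c c' c''} ⟨φ, h⟩ ⟨ψ, h'⟩ => ⟨φ * ψ, fun j => by
        ext x; simp [res, h, h']; group⟩ }

/-- The first Real cohomology of a pre-simplicial Real open cover. -/
def HR1ss (S : Type u) [Group S] [TopologicalSpace S] [RealGroup S] : Type u :=
  Quotient (V.cohSetoid S)

end Group

section CommGroup

variable [CommGroup S] [TopologicalSpace S] [RealGroup S]

/-- The differential `(dc)_j = ∏_k (ε_k^* c_{ε_k(j)})^{(-1)^k}`. -/
def d (n : ℕ) (c : V.CR S n) (j : (V.cov (n + 1)).J) : C((V.cov (n + 1)).U j, S) :=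
  ∏ k : Fin (n + 2), V.res c.1 (ε k) j ^ ((-1 : ℤ) ^ (k : ℕ))

/-- For commutative `S`, a Real `1`-cochain is a cocycle if and only if `dc = 1`. -/
theorem cocycle_iff (c : V.CR S 1) :
    (∀ j : (V.cov 2).J, V.res c.1 (ε 1) j = V.res c.1 (ε 2) j * V.res c.1 (ε 0) j) ↔
      ∀ j, V.d 1 c j = 1 := by
  refine forall_congr' fun j => ?_
  have h : V.d 1 c j = V.res c.1 (ε 0) j ^ ((-1 : ℤ) ^ 0) * V.res c.1 (ε 1) j ^ ((-1 : ℤ) ^ 1) *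
      V.res c.1 (ε 2) j ^ ((-1 : ℤ) ^ 2) :=
    Fin.prod_univ_three fun k : Fin 3 => V.res c.1 (ε k) j ^ ((-1 : ℤ) ^ (k : ℕ))
  rw [h]
  simp only [pow_zero, pow_one, even_two, Even.neg_pow, one_pow, zpow_one, zpow_neg]
  rw [mul_right_comm, mul_inv_eq_one, mul_comm (V.res c.1 (ε 0) j), eq_comm]

/-- For commutative `S`, cohomologous cocycles are those that differ by a coboundary. -/
theorem cohomologous_iff (c c' : V.ZR1 S) :
    c ≈ c' ↔ ∃ φ : V.CR S 0, ∀ j, c'.1.1 j = c.1.1 j * V.d 0 φ j := by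
  refine exists_congr fun φ => forall_congr' fun j => ?_
  have h : V.d 0 φ j = V.res φ.1 (ε 0) j ^ ((-1 : ℤ) ^ 0) * V.res φ.1 (ε 1) j ^ ((-1 : ℤ) ^ 1) :=
    Fin.prod_univ_two fun k : Fin 2 => V.res φ.1 (ε k) j ^ ((-1 : ℤ) ^ (k : ℕ))
  rw [h]
  simp only [pow_zero, pow_one, zpow_one, zpow_neg]
  rw [mul_assoc, mul_comm, mul_assoc]

/-- Real `1`-cocycles form a subgroup of the group of cochains. -/
def ZR1Subgroup (S : Type u) [CommGroup S] [TopologicalSpace S] [RealGroup S] :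
    Subgroup (V.CR S 1) where
  carrier := {c | ∀ j : (V.cov 2).J, V.res c.1 (ε 1) j = V.res c.1 (ε 2) j * V.res c.1 (ε 0) j}
  mul_mem' := fun {a b} ha hb j => by
    have h1 := ha j
    have h2 := hb j
    ext x
    have h1 := congrArg (fun c => c x) h1
    have h2 := congrArg (fun c => c x) h2
    simp [res] at h1 h2 ⊢
    rw [h1, h2, mul_mul_mul_comm]
  one_mem' := fun j => by ext x; simp [res]
  inv_mem' := fun {a} ha j => by
    ext x
    have h1 := congrArg (fun c => c x) (ha j)
    simp [res] at h1 ⊢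
    rw [h1, mul_inv]

instance : CommGroup (V.ZR1 S) :=
  inferInstanceAs (CommGroup (V.ZR1Subgroup S))

theorem mul_apply (a b : V.ZR1 S) (j : (V.cov 1).J) (x : (V.cov 1).U j) :
    (a * b).1.1 j x = a.1.1 j x * b.1.1 j x := rfl

/-- The congruence modulo coboundaries. -/
def cohCon (S : Type u) [CommGroup S] [TopologicalSpace S] [RealGroup S] : Con (V.ZR1 S) where
  toSetoid := V.cohSetoid S
  mul' := fun {a b a' b'} ⟨φ, h⟩ ⟨ψ, h'⟩ => ⟨φ * ψ, fun j => by
    ext x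
    have h1 := congrArg (fun c => c x) (h j)
    have h2 := congrArg (fun c => c x) (h' j)
    simp only [res, ContinuousMap.mul_apply, ContinuousMap.inv_apply, ContinuousMap.comp_apply,
      Subgroup.coe_mul, Pi.mul_apply, mul_apply] at h1 h2 ⊢
    rw [h1, h2, mul_inv, mul_mul_mul_comm, mul_mul_mul_comm (_⁻¹)]⟩

/-- For commutative `S`, the first Real cohomology of a cover is a group. -/
instance : CommGroup (V.HR1ss S) :=
  inferInstanceAs (CommGroup (V.cohCon S).Quotient)

end CommGroup

/-- A pre-simplicial refinement from `W` to `V`. -/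
structure Refinement (W V : PreSimplicialCover G) where
  θ : ∀ n, (W.cov n).J → (V.cov n).J
  θ_bar : ∀ n i, θ n ((W.cov n).bar i) = (V.cov n).bar (θ n i)
  subset : ∀ n i, (W.cov n).U i ⊆ (V.cov n).U (θ n i)
  θ_face : ∀ {m n : ℕ} (f : Fin (m + 1) ↪o Fin (n + 1)) (i : (W.cov n).J),
    θ m (W.face f i) = V.face f (θ n i)

namespace Refinement

variable {V} {W : PreSimplicialCover G} (θ : Refinement W V)

section Group

variable [Group S] [TopologicalSpace S] [RealGroup S]

/-- The restriction `(θ^* c)_i = c_{θ(i)}|_{W_i}` of cochains. -/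
def cochain (n : ℕ) (c : V.CR S n) : W.CR S n :=
  ⟨fun i => (c.1 (θ.θ n i)).comp (ContinuousMap.inclusion (θ.subset n i)), fun i x hx => by
    have := c.2 (θ.θ n i) x (θ.subset n i hx)
    rw [ContinuousMap.comp_apply, ContinuousMap.comp_apply]
    refine Eq.trans ?_ this
    have key : ∀ j j' (h : j = j') (y : Nerve G n) (hy : y ∈ (V.cov n).U j)
        (hy' : y ∈ (V.cov n).U j'), c.1 j ⟨y, hy⟩ = c.1 j' ⟨y, hy'⟩ := by
      rintro j _ rfl y hy hy'; rfl
    exact key _ _ (θ.θ_bar n i) _ _ _⟩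

theorem res_cochain {m n : ℕ} (c : V.CR S m) (f : Fin (m + 1) ↪o Fin (n + 1)) (i : (W.cov n).J) :
    W.res (θ.cochain m c).1 f i =
      (V.res c.1 f (θ.θ n i)).comp (ContinuousMap.inclusion (θ.subset n i)) := by
  ext x
  have key : ∀ j j' (h : j = j') (y : Nerve G m) (hy : y ∈ (V.cov m).U j)
      (hy' : y ∈ (V.cov m).U j'), c.1 j ⟨y, hy⟩ = c.1 j' ⟨y, hy'⟩ := by
    rintro j _ rfl y hy hy'; rfl
  exact key _ _ (θ.θ_face f i) _ _ _

/-- The restriction of cocycles. -/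
def cocycle (c : V.ZR1 S) : W.ZR1 S :=
  ⟨θ.cochain 1 c.1, fun i => by
    simp only [res_cochain, c.2 (θ.θ 2 i)]
    rfl⟩

/-- The map induced by a refinement in cohomology. -/
def map : V.HR1ss S → W.HR1ss S :=
  Quotient.map' θ.cocycle fun c c' ⟨φ, h⟩ => ⟨θ.cochain 0 φ, fun i => by
    simp only [res_cochain]
    show (c'.1.1 (θ.θ 1 i)).comp _ = _
    rw [h]
    rfl⟩

end Group

theorem map_mul [CommGroup S] [TopologicalSpace S] [RealGroup S] (x y : V.HR1ss S) :
    θ.map (x * y) = θ.map x * θ.map y := by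
  induction x using Quotient.inductionOn
  induction y using Quotient.inductionOn
  rfl

theorem map_one [CommGroup S] [TopologicalSpace S] [RealGroup S] :
    θ.map (1 : V.HR1ss S) = 1 := rfl

theorem map_inv [CommGroup S] [TopologicalSpace S] [RealGroup S] (x : V.HR1ss S) :
    θ.map x⁻¹ = (θ.map x)⁻¹ := by
  induction x using Quotient.inductionOn
  rfl

end Refinement

end PreSimplicialCover

namespace NerveCover

variable {G : RealGroupoid.{u}}

/-- The pre-simplicial Real open cover `♮U` associated to a Real open cover `U`: its index set
`Λ_n` consists of the families `λ = (λ_φ)` with `λ_φ ∈ J_k` for every strictly increasing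
`φ : [k] → [n]`, and `U^n_λ = ⋂_φ φ̃⁻¹(U^k_{λ_φ})`. -/
def nat (U : NerveCover G) : PreSimplicialCover G where
  cov n :=
    { J := ∀ k : ℕ, (Fin (k + 1) ↪o Fin (n + 1)) → (U k).J
      bar := fun l k φ => (U k).bar (l k φ)
      bar_bar := fun l => funext fun k => funext fun φ => (U k).bar_bar _
      U := fun l => {x | ∀ k φ, Nerve.face φ x ∈ (U k).U (l k φ)}
      isOpen_U := fun l => by
        have : {x : Nerve G n | ∀ k φ, Nerve.face φ x ∈ (U k).U (l k φ)} =
            ⋂ k ∈ Finset.range (n + 1), ⋂ φ : Fin (k + 1) ↪o Fin (n + 1),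
              Nerve.face φ ⁻¹' (U k).U (l k φ) := by
          ext x
          simp only [mem_ofPred_eq, mem_iInter, mem_preimage, Finset.mem_range]
          refine ⟨fun h k _ φ => h k φ, fun h k φ => h k ?_ φ⟩
          have := Fintype.card_le_of_injective φ φ.injective
          simpa using this
        rw [this]
        refine isOpen_biInter_finset fun k _ => isOpen_iInter_of_finite fun φ => ?_
        exact ((U k).isOpen_U _).preimage (Nerve.continuous_face φ)
      exists_mem := fun x => ⟨fun k φ => ((U k).exists_mem (Nerve.face φ x)).choose,
        fun k φ => ((U k).exists_mem (Nerve.face φ x)).choose_spec⟩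
      U_bar := fun l => by
        have key : ∀ (l : ∀ k : ℕ, (Fin (k + 1) ↪o Fin (n + 1)) → (U k).J) (x : Nerve G n),
            (∀ k φ, Nerve.face φ x ∈ (U k).U (l k φ)) →
              ∀ k φ, Nerve.face φ (Nerve.ρ x) ∈ (U k).U ((U k).bar (l k φ)) :=
          fun l x h k φ => (U k).mem_bar (h k φ)
        ext x
        constructor
        · intro h
          refine ⟨Nerve.ρ x, ?_, Nerve.ρ_ρ x⟩
          intro k φ
          have := key _ x h k φ
          rwa [(U k).bar_bar] at this
        · rintro ⟨y, hy, rfl⟩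
          exact key l y hy }
  face f l := fun k φ => l k (φ.trans f)
  face_id _ := rfl
  face_comp _ _ _ := rfl
  face_bar _ _ := rfl
  face_mem f _ _ hx := fun k φ => hx k (φ.trans f)

/-- The `N`-skeleton of `U` admits an `N`-simplicial Real structure: all increasing maps
`f : [m] → [n]` with `m, n ≤ N` act on the index sets, compatibly with the involutions, and
`f̃(U^n_j) ⊆ U^m_{f̃(j)}`. -/
def HasSimplicialStructure (U : NerveCover G) (N : ℕ) : Prop :=
  ∃ F : ∀ {m n : ℕ}, m ≤ N → n ≤ N → (Fin (m + 1) →o Fin (n + 1)) → (U n).J → (U m).J,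
    (∀ {n : ℕ} (hn : n ≤ N) (j : (U n).J), F hn hn OrderHom.id j = j) ∧
    (∀ {l m n : ℕ} (hl : l ≤ N) (hm : m ≤ N) (hn : n ≤ N) (f : Fin (l + 1) →o Fin (m + 1))
      (g : Fin (m + 1) →o Fin (n + 1)) (j : (U n).J),
      F hl hn (g.comp f) j = F hl hm f (F hm hn g j)) ∧
    (∀ {m n : ℕ} (hm : m ≤ N) (hn : n ≤ N) (f : Fin (m + 1) →o Fin (n + 1)) (j : (U n).J),
      F hm hn f ((U n).bar j) = (U m).bar (F hm hn f j)) ∧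
    ∀ {m n : ℕ} (hm : m ≤ N) (hn : n ≤ N) (f : Fin (m + 1) →o Fin (n + 1)) (j : (U n).J),
      ∀ x ∈ (U n).U j, Nerve.face f x ∈ (U m).U (F hm hn f j)

theorem HasSimplicialStructure.mono {U : NerveCover G} {M N : ℕ} (h : U.HasSimplicialStructure N)
    (hM : M ≤ N) : U.HasSimplicialStructure M := by
  obtain ⟨F, h1, h2, h3, h4⟩ := h
  exact ⟨fun hm hn => F (hm.trans hM) (hn.trans hM), fun _ _ => h1 _ _,
    fun _ _ _ _ _ _ => h2 _ _ _ _ _ _, fun _ _ _ _ => h3 _ _ _ _, fun _ _ _ _ => h4 _ _ _ _⟩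

/-- A refinement from `W` to `U`. -/
structure Refinement (W U : NerveCover G) where
  θ : ∀ n, (W n).J → (U n).J
  θ_bar : ∀ n i, θ n ((W n).bar i) = (U n).bar (θ n i)
  subset : ∀ n i, (W n).U i ⊆ (U n).U (θ n i)

/-- The refinement of the associated pre-simplicial covers. -/
def Refinement.nat {W U : NerveCover G} (θ : Refinement W U) :
    PreSimplicialCover.Refinement W.nat U.nat where
  θ _ l := fun k φ => θ.θ k (l k φ)
  θ_bar _ _ := funext fun k => funext fun _ => θ.θ_bar k _
  subset _ _ := fun _ hx k φ => θ.subset k _ (hx k φ)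
  θ_face _ _ := rfl

/-- Composition of refinements. -/
def Refinement.comp {W V U : NerveCover G} (θ : Refinement V U) (η : Refinement W V) :
    Refinement W U where
  θ n i := θ.θ n (η.θ n i)
  θ_bar n i := by rw [η.θ_bar, θ.θ_bar]
  subset n i := (η.subset n i).trans (θ.subset n _)

theorem Refinement.map_comp {S : Type u} [Group S] [TopologicalSpace S] [RealGroup S]
    {W V U : NerveCover G} (θ : Refinement V U) (η : Refinement W V) (x : U.nat.HR1ss S) :
    (θ.comp η).nat.map x = η.nat.map (θ.nat.map x) := by
  induction x using Quotient.inductionOn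
  rfl

/-- The cover by the sets `U_j ∩ V_{j'}`. -/
def prod (U V : NerveCover G) : NerveCover G := fun n =>
  { J := (U n).J × (V n).J
    bar := fun j => ((U n).bar j.1, (V n).bar j.2)
    bar_bar := fun j => Prod.ext ((U n).bar_bar _) ((V n).bar_bar _)
    U := fun j => (U n).U j.1 ∩ (V n).U j.2
    isOpen_U := fun j => ((U n).isOpen_U _).inter ((V n).isOpen_U _)
    exists_mem := fun x => by
      obtain ⟨j, hj⟩ := (U n).exists_mem x
      obtain ⟨k, hk⟩ := (V n).exists_mem x
      exact ⟨(j, k), hj, hk⟩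
    U_bar := fun j => by
      rw [image_inter (Function.LeftInverse.injective Nerve.ρ_ρ), (U n).U_bar, (V n).U_bar] }

/-- The cover with one member in each degree. -/
def trivial (G : RealGroupoid.{u}) : NerveCover G := fun _ =>
  { J := PUnit
    bar := id
    bar_bar := fun _ => rfl
    U := fun _ => univ
    isOpen_U := fun _ => isOpen_univ
    exists_mem := fun _ => ⟨PUnit.unit, Set.mem_univ _⟩
    U_bar := fun _ => (image_univ_of_surjective fun x => ⟨_, Nerve.ρ_ρ x⟩).symm }

theorem HasSimplicialStructure.prod {U V : NerveCover G} {N : ℕ}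
    (h : U.HasSimplicialStructure N) (h' : V.HasSimplicialStructure N) :
    (U.prod V).HasSimplicialStructure N := by
  obtain ⟨F, h1, h2, h3, h4⟩ := h
  obtain ⟨F', h1', h2', h3', h4'⟩ := h'
  exact ⟨fun hm hn f j => (F hm hn f j.1, F' hm hn f j.2),
    fun _ _ => Prod.ext (h1 _ _) (h1' _ _),
    fun _ _ _ _ _ _ => Prod.ext (h2 _ _ _ _ _ _) (h2' _ _ _ _ _ _),
    fun _ _ _ _ => Prod.ext (h3 _ _ _ _) (h3' _ _ _ _),
    fun _ _ _ _ x hx => ⟨h4 _ _ _ _ x hx.1, h4' _ _ _ _ x hx.2⟩⟩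

theorem HasSimplicialStructure.trivial (N : ℕ) :
    (NerveCover.trivial G).HasSimplicialStructure N :=
  ⟨fun _ _ _ j => j, fun _ _ => rfl, fun _ _ _ _ _ _ => rfl, fun _ _ _ _ => rfl,
    fun _ _ _ _ _ _ => Set.mem_univ _⟩

/-- The first projection of `U × V`. -/
def prodFst (U V : NerveCover G) : Refinement (U.prod V) U where
  θ _ j := j.1
  θ_bar _ _ := rfl
  subset _ _ _ hx := hx.1

/-- The second projection of `U × V`. -/
def prodSnd (U V : NerveCover G) : Refinement (U.prod V) V where
  θ _ j := j.2
  θ_bar _ _ := rfl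
  subset _ _ _ hx := hx.2

/-- A refinement of both `U` and `V` is a refinement of `U × V`. -/
def Refinement.pair {W U V : NerveCover G} (θ : Refinement W U) (η : Refinement W V) :
    Refinement W (U.prod V) where
  θ n i := (θ.θ n i, η.θ n i)
  θ_bar n i := Prod.ext (θ.θ_bar n i) (η.θ_bar n i)
  subset n i := subset_inter (θ.subset n i) (η.subset n i)

/-- Every cover refines the cover with one member. -/
def Refinement.toTrivial (W : NerveCover G) : Refinement W (trivial G) where
  θ _ _ := PUnit.unit
  θ_bar _ _ := rfl
  subset _ _ := subset_univ _

end NerveCover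

/-- The collection `𝔑(1)` of Real open covers of `G_•` whose `N`-skeleton admits an
`N`-simplicial Real structure for some `N ≥ 2`. -/
structure NerveCover.Adm (G : RealGroupoid.{u}) where
  cov : NerveCover G
  exists_simplicial : ∃ N, 2 ≤ N ∧ cov.HasSimplicialStructure N

namespace NerveCover.Adm

variable {G : RealGroupoid.{u}}

/-- The product in `𝔑(1)`. -/
abbrev prod (U V : Adm G) : Adm G where
  cov := U.cov.prod V.cov
  exists_simplicial := by
    obtain ⟨N, hN, h⟩ := U.exists_simplicial
    obtain ⟨N', hN', h'⟩ := V.exists_simplicial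
    exact ⟨min N N', le_min hN hN', (h.mono (min_le_left _ _)).prod (h'.mono (min_le_right _ _))⟩

/-- The trivial cover, in `𝔑(1)`. -/
abbrev trivial (G : RealGroupoid.{u}) : Adm G where
  cov := NerveCover.trivial G
  exists_simplicial := ⟨2, le_rfl, .trivial 2⟩

end NerveCover.Adm

/-- The relation generating the direct limit of the sets `HR¹(U, S) = HR¹_ss(♮U, S)`. -/
inductive CechRel (G : RealGroupoid.{u}) (S : Type u) [Group S] [TopologicalSpace S] [RealGroup S] :
    (Σ U : NerveCover.Adm G, U.cov.nat.HR1ss S) → (Σ U : NerveCover.Adm G, U.cov.nat.HR1ss S) → Prop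
  | of (U W : NerveCover.Adm G) (θ : NerveCover.Refinement W.cov U.cov) (x : U.cov.nat.HR1ss S) :
      CechRel G S ⟨U, x⟩ ⟨W, θ.nat.map x⟩

/-- The first Real Čech cohomology of `G_•` with coefficients in the Real group `S`: the direct
limit of `HR¹(U, S)` over the covers `U` in `𝔑(1)`. -/
def CechHR1 (G : RealGroupoid.{u}) (S : Type u) [Group S] [TopologicalSpace S] [RealGroup S] :
    Type (u + 1) :=
  Quot (CechRel G S)

namespace CechHR1

variable {G : RealGroupoid.{u}} {S : Type u}

section Group

variable [Group S] [TopologicalSpace S] [RealGroup S]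

/-- The class of a cohomology class of the cover `U`. -/
def of (U : NerveCover.Adm G) (x : U.cov.nat.HR1ss S) : CechHR1 G S :=
  Quot.mk _ ⟨U, x⟩

/-- The class of a cocycle over the cover `U`. -/
def mk (U : NerveCover.Adm G) (c : U.cov.nat.ZR1 S) : CechHR1 G S :=
  of U (Quotient.mk _ c)

theorem of_map {U W : NerveCover.Adm G} (θ : NerveCover.Refinement W.cov U.cov)
    (x : U.cov.nat.HR1ss S) : of W (θ.nat.map x) = of U x :=
  (Quot.sound (CechRel.of U W θ x)).symm

theorem ind {C : CechHR1 G S → Prop} (h : ∀ U x, C (of U x)) (a : CechHR1 G S) : C a :=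
  Quot.ind (fun p => h p.1 p.2) a

end Group

section CommGroup

variable [CommGroup S] [TopologicalSpace S] [RealGroup S]

/-- The sum of classes over two covers, over the cover by intersections. -/
def mulAux (U V : NerveCover.Adm G) (x : U.cov.nat.HR1ss S) (y : V.cov.nat.HR1ss S) : CechHR1 G S :=
  of (U.prod V) ((NerveCover.prodFst U.cov V.cov).nat.map x * (NerveCover.prodSnd U.cov V.cov).nat.map y)

theorem mulAux_eq {U V W : NerveCover.Adm G} (θ : NerveCover.Refinement W.cov U.cov)
    (η : NerveCover.Refinement W.cov V.cov) (x : U.cov.nat.HR1ss S) (y : V.cov.nat.HR1ss S) :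
    mulAux U V x y = of W (θ.nat.map x * η.nat.map y) := by
  have h1 := NerveCover.Refinement.map_comp (NerveCover.prodFst U.cov V.cov) (θ.pair η) x
  have h2 := NerveCover.Refinement.map_comp (NerveCover.prodSnd U.cov V.cov) (θ.pair η) y
  refine (of_map (U := U.prod V) (W := W) (θ.pair η) _).symm.trans (congrArg (of W) ?_)
  exact (PreSimplicialCover.Refinement.map_mul _ _ _).trans
    (congrArg₂ (· * ·) h1.symm h2.symm)

instance : Mul (CechHR1 G S) :=
  ⟨Quot.lift₂ (fun p q => mulAux p.1 q.1 p.2 q.2)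
    (by
      rintro ⟨U, x⟩ _ _ ⟨V, W, θ, y⟩
      exact (mulAux_eq (W := U.prod W) (NerveCover.prodFst _ _)
        (θ.comp (NerveCover.prodSnd U.cov W.cov)) x y).trans
        (congrArg (fun z => of (U.prod W) ((NerveCover.prodFst U.cov W.cov).nat.map x * z))
          (NerveCover.Refinement.map_comp θ (NerveCover.prodSnd U.cov W.cov) y)))
    (by
      rintro _ _ ⟨V, y⟩ ⟨U, W, θ, x⟩
      exact (mulAux_eq (W := W.prod V) (θ.comp (NerveCover.prodFst W.cov V.cov))
        (NerveCover.prodSnd _ _) x y).trans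
        (congrArg (fun z => of (W.prod V) (z * (NerveCover.prodSnd W.cov V.cov).nat.map y))
          (NerveCover.Refinement.map_comp θ (NerveCover.prodFst W.cov V.cov) x)))⟩

theorem of_mul_of {U V W : NerveCover.Adm G} (θ : NerveCover.Refinement W.cov U.cov)
    (η : NerveCover.Refinement W.cov V.cov) (x : U.cov.nat.HR1ss S) (y : V.cov.nat.HR1ss S) :
    of U x * of V y = of W (θ.nat.map x * η.nat.map y) :=
  mulAux_eq θ η x y

theorem of_mul (W : NerveCover.Adm G) (x y : W.cov.nat.HR1ss S) :
    of W x * of W y = of W (x * y) := by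
  rw [of_mul_of (W := W) ⟨fun _ i => i, fun _ _ => rfl, fun _ _ => subset_rfl⟩
    ⟨fun _ i => i, fun _ _ => rfl, fun _ _ => subset_rfl⟩]
  congr 2
  · induction x using Quotient.inductionOn; rfl
  · induction y using Quotient.inductionOn; rfl

instance : One (CechHR1 G S) := ⟨of (NerveCover.Adm.trivial G) 1⟩

theorem of_one (W : NerveCover.Adm G) : of W (1 : W.cov.nat.HR1ss S) = 1 :=
  (congrArg (of W) (PreSimplicialCover.Refinement.map_one _)).symm.trans
    (of_map (U := NerveCover.Adm.trivial G) (NerveCover.Refinement.toTrivial W.cov) 1)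

instance : Inv (CechHR1 G S) :=
  ⟨Quot.lift (fun p => of p.1 p.2⁻¹) (by
    rintro _ _ ⟨U, W, θ, x⟩
    rw [← PreSimplicialCover.Refinement.map_inv, of_map])⟩

theorem of_inv (W : NerveCover.Adm G) (x : W.cov.nat.HR1ss S) : (of W x)⁻¹ = of W x⁻¹ := rfl

/-- Two classes come from the same cover. -/
theorem ind₂ {C : CechHR1 G S → CechHR1 G S → Prop} (h : ∀ W x y, C (of W x) (of W y))
    (a b : CechHR1 G S) : C a b := by
  induction a using ind with | _ U x
  induction b using ind with | _ V y
  rw [← of_map (W := U.prod V) (NerveCover.prodFst U.cov V.cov) x,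
    ← of_map (W := U.prod V) (NerveCover.prodSnd U.cov V.cov) y]
  exact h _ _ _

/-- Three classes come from the same cover. -/
theorem ind₃ {C : CechHR1 G S → CechHR1 G S → CechHR1 G S → Prop}
    (h : ∀ W x y z, C (of W x) (of W y) (of W z)) (a b c : CechHR1 G S) : C a b c := by
  induction a, b using ind₂ with | _ U x y
  induction c using ind with | _ V z
  rw [← of_map (W := U.prod V) (NerveCover.prodFst U.cov V.cov) x,
    ← of_map (W := U.prod V) (NerveCover.prodFst U.cov V.cov) y,
    ← of_map (W := U.prod V) (NerveCover.prodSnd U.cov V.cov) z]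
  exact h _ _ _ _

/-- For commutative `S`, the first Real Čech cohomology is a group. -/
instance : CommGroup (CechHR1 G S) where
  mul_assoc a b c := by
    induction a, b, c using ind₃ with | _ W x y z
    simp only [of_mul, mul_assoc]
  one_mul a := by
    induction a using ind with | _ W x
    rw [← of_one W, of_mul, one_mul]
  mul_one a := by
    induction a using ind with | _ W x
    rw [← of_one W, of_mul, mul_one]
  inv_mul_cancel a := by
    induction a using ind with | _ W x
    rw [of_inv, of_mul, inv_mul_cancel, of_one]
  mul_comm a b := by
    induction a, b using ind₂ with | _ W x y
    rw [of_mul, of_mul, mul_comm]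

end CommGroup

end CechHR1

/-- `s` is a Real family of continuous local sections of `rng : Z → X` over the cover in degree `0`,
and `c` is its transition cocycle: `g · s_{j₁}(s(g)) = s_{j₀}(r(g)) · c_{j₀j₁}(g)`. -/
structure RealGenHom.IsTransition {G : RealGroupoid.{u}} {S : Type u} [Group S]
    [TopologicalSpace S] [RealGroup S] (Z : RealGenHom G (RealGroupoid.ofGroup S))
    (V : PreSimplicialCover G) (s : ∀ j : (V.cov 0).J, C((V.cov 0).U j, Z.Z))
    (c : V.ZR1 S) : Prop where
  rng_s : ∀ j x, Z.rng (s j x) = x.1.obj 0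
  s_bar : ∀ j x (hx : x ∈ (V.cov 0).U j),
    s ((V.cov 0).bar j) ⟨Nerve.ρ x, (V.cov 0).mem_bar hx⟩ = Z.τ (s j ⟨x, hx⟩)
  lact_s : ∀ j x (hx : x ∈ (V.cov 1).U j) (e : G.s (x.arr 0 1) =
      Z.rng (s _ ⟨_, V.face_mem (PreSimplicialCover.ε 0) j x hx⟩)),
    Z.lact (x.arr 0 1) (s _ ⟨_, V.face_mem (PreSimplicialCover.ε 0) j x hx⟩) e =
      Z.act (s _ ⟨_, V.face_mem (PreSimplicialCover.ε 1) j x hx⟩) (c.1.1 j ⟨x, hx⟩)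

/-! A principal `S`-bundle is recovered from the comparison of its local sections, and here the
groupoid action and the Real structure are encoded in the same comparison. Given sections `s_a` over
a cover of `X`, the action of `S` is simply transitive on fibres with a continuous division map, so
`g · s_b(s(g)) = s_a(r(g)) · c_ab(g)` defines a unique continuous `c_ab(g)`. Associativity of the
left action is the cocycle identity, and `s_ā ∘ ρ = τ ∘ s_a` makes `c` Real. Such Real families of
sections exist because a local section and its conjugate can be listed under two different indices
(`exists_realCover`); `IsTransition.equiv` and `IsTransition.mk_eq` show that the resulting class
depends only on the isomorphism class of the bundle: another choice of sections is `s_a φ_a`, which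
changes `c` by the coboundary of `φ`, and different covers are compared on their intersections.

Conversely, a bundle must be built from a cocycle over `♮U`. The difficulty is that a member of `♮U`
in degree 1 carries an edge index besides its two vertex indices, while gluing data may depend on
the vertices only. The 2-cell index of a member in degree 2 can be chosen freely around a given
composable pair, so the cocycle identity holds whenever the vertices match (`eval_mul`); applied to
`g = g · 1`, it shows that the edge index does not affect the value (`eval_eq`). What remains is a
function `c_ab(g)` (`arrEval`). Its values at units are the transition functions of a bundle with
fibre `S`; the groupoid acts in charts by left multiplication by `c_ab(g)`, the Real structure by
conjugation, and `S` by right multiplication. The sections with coordinate `1` have transition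
cocycle `c` (`isTransition_genHom`).

The two constructions are mutually inverse because bundles with the same transition cocycle are
isomorphic, through the map that matches their sections (`IsTransition.nonempty_iso`). For abelian
`S`, the sections `[s_a, s'_a]` of a sum have transition cocycle `c c'`, and those of the inverse
have `c⁻¹`. The bijection therefore respects the operations, and the group laws on the set of
isomorphism classes are transported from Čech cohomology. -/

namespace RealGroupoid

/-! ### Algebra in a groupoid -/

variable (G : RealGroupoid.{u})

/-- A product contains a proof of composability, which blocks rewriting in a single factor; both
factors are replaced at once instead. -/
theorem mul_congr {g g' h h' : G.Arr} (hg : g = g') (hh : h = h') (e : G.s g = G.r h)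
    (e' : G.s g' = G.r h') : G.mul g h e = G.mul g' h' e' := by
  subst hg hh; rfl

theorem inv_mul_cancel_left (g h : G.Arr) (e : G.s g = G.r h) :
    G.mul (G.inv g) (G.mul g h e) ((G.s_inv g).trans (G.r_mul g h e).symm) = h := by
  rw [← G.mul_assoc _ _ _ (G.s_inv g) e,
    G.mul_congr ((G.inv_mul g).trans (congrArg G.unit e)) rfl _ (G.s_unit _), G.unit_mul]

theorem eq_inv_of_mul_eq_unit {g h : G.Arr} (e : G.s g = G.r h)
    (hgh : G.mul g h e = G.unit (G.r g)) : h = G.inv g := by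
  have h1 := G.inv_mul_cancel_left g h e
  rw [← h1, G.mul_congr rfl (hgh.trans (congrArg G.unit (G.s_inv g).symm)) _ (G.r_unit _).symm,
    G.mul_unit]

theorem unit_mul_unit (x : G.Obj) (e : G.s (G.unit x) = G.r (G.unit x)) :
    G.mul (G.unit x) (G.unit x) e = G.unit x := by
  rw [G.mul_congr rfl (congrArg G.unit (G.s_unit x).symm) e (G.r_unit _).symm, G.mul_unit]

theorem inv_unit (x : G.Obj) : G.inv (G.unit x) = G.unit x :=
  (G.eq_inv_of_mul_eq_unit ((G.s_unit x).trans (G.r_unit x).symm)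
    ((G.unit_mul_unit x _).trans (congrArg G.unit (G.r_unit x).symm))).symm

theorem inv_inv (g : G.Arr) : G.inv (G.inv g) = g :=
  (G.eq_inv_of_mul_eq_unit (G.s_inv g) ((G.inv_mul g).trans (congrArg G.unit (G.r_inv g).symm))).symm

theorem mul_inv_unit (g : G.Arr) (x : G.Obj) (e : G.s g = G.r (G.inv (G.unit x))) :
    G.mul g (G.inv (G.unit x)) e = g := by
  have hx : G.s g = x := e.trans ((G.r_inv _).trans (G.s_unit x))
  subst hx
  rw [G.mul_congr rfl (G.inv_unit _) _ (G.r_unit _).symm, G.mul_unit]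

theorem mul_mul_inv (g h : G.Arr) (e : G.s g = G.r h)
    (e' : G.s (G.mul g h e) = G.r (G.inv h)) : G.mul (G.mul g h e) (G.inv h) e' = g := by
  rw [G.mul_assoc g h _ e (G.r_inv h).symm, G.mul_congr rfl ((G.mul_inv h).trans
    (congrArg G.unit e.symm)) _ (G.r_unit _).symm, G.mul_unit]

variable {G}

theorem continuous_mul_comp {T : Type*} [TopologicalSpace T] {f g : T → G.Arr} (hf : Continuous f)
    (hg : Continuous g) (e : ∀ t, G.s (f t) = G.r (g t)) :
    Continuous fun t => G.mul (f t) (g t) (e t) :=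
  G.continuous_mul.comp
    (f := fun t => (⟨(f t, g t), e t⟩ : {p : G.Arr × G.Arr // G.s p.1 = G.r p.2}))
    ((hf.prodMk hg).subtype_mk _)

/-! ### Strings of length at most two -/

namespace Nerve

variable {n : ℕ}

/-- The element `(aᵢ aⱼ⁻¹)ᵢⱼ` of the nerve defined by arrows `aᵢ` with the same source. -/
def cone (a : Fin (n + 1) → G.Arr) (h : ∀ i j, G.s (a i) = G.s (a j)) : Nerve G n where
  obj i := G.r (a i)
  arr i j := G.mul (a i) (G.inv (a j)) ((h i j).trans (G.r_inv _).symm)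
  r_arr i j := G.r_mul _ _ _
  s_arr i j := (G.s_mul _ _ _).trans (G.s_inv _)
  arr_self i := G.mul_inv _
  arr_mul i j k := by
    have e1 : G.s (G.inv (a j)) = G.r (G.mul (a j) (G.inv (a k)) ((h j k).trans (G.r_inv _).symm)) :=
      (G.s_inv _).trans (G.r_mul _ _ _).symm
    rw [G.mul_assoc _ _ _ ((h i j).trans (G.r_inv _).symm) e1]
    exact G.mul_congr rfl (G.inv_mul_cancel_left _ _ _) _ _

theorem continuous_cone {T : Type*} [TopologicalSpace T] {a : T → Fin (n + 1) → G.Arr}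
    (ha : ∀ i, Continuous fun t => a t i) (h : ∀ t i j, G.s (a t i) = G.s (a t j)) :
    Continuous fun t => cone (a t) (h t) := by
  refine continuous_induced_rng.2 (Continuous.prodMk ?_ ?_)
  · exact continuous_pi fun i => G.continuous_r.comp (ha i)
  · exact continuous_pi fun i => continuous_pi fun j =>
      continuous_mul_comp (ha i) (G.continuous_inv.comp (ha j)) _

/-- The vertex `x`, as an element of the nerve. -/
def ofObj (x : G.Obj) : Nerve G 0 := cone (fun _ => G.unit x) fun _ _ => rfl

/-- The arrow `g`, as an element of the nerve. -/
def ofArr (g : G.Arr) : Nerve G 1 := cone ![g, G.unit (G.s g)] (by simp [G.s_unit])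

/-- The composable pair `(g, h)`, as an element of the nerve. -/
def ofPair (g h : G.Arr) (e : G.s g = G.r h) : Nerve G 2 :=
  -- All three arrows start at `s(h)`; their quotients are `(gh)h⁻¹ = g`, `h` and `gh`.
  cone ![G.mul g h e, h, G.unit (G.s h)] (by simp [Fin.forall_fin_succ, G.s_unit, G.s_mul])

theorem continuous_ofObj : Continuous (ofObj : G.Obj → Nerve G 0) :=
  continuous_cone (fun _ => G.continuous_unit) _

theorem continuous_ofArr : Continuous (ofArr : G.Arr → Nerve G 1) := by
  refine continuous_cone (fun i => ?_) _
  match i with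
  | 0 => exact continuous_id
  | 1 => exact G.continuous_unit.comp G.continuous_s

theorem continuous_obj (i : Fin (n + 1)) : Continuous fun x : Nerve G n => x.obj i :=
  (continuous_apply i).comp (continuous_fst.comp continuous_pair)

theorem continuous_arr (i j : Fin (n + 1)) : Continuous fun x : Nerve G n => x.arr i j :=
  (continuous_apply j).comp ((continuous_apply i).comp (continuous_snd.comp continuous_pair))

theorem ext_obj {x y : Nerve G 0} (h : x.obj 0 = y.obj 0) : x = y := by
  have h' : x.obj = y.obj := funext fun i => by rw [Fin.fin_one_eq_zero i, h]
  refine Nerve.ext h' (funext fun i => funext fun j => ?_)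
  rw [Fin.fin_one_eq_zero i, Fin.fin_one_eq_zero j, x.arr_self, y.arr_self, h']

/-- The reversed arrow is forced: its composite with the arrow `0 1` is a unit, so it is the
inverse. Thus `G_1` is the set of arrows. -/
theorem ext_arr {x y : Nerve G 1} (h : x.arr 0 1 = y.arr 0 1) : x = y := by
  have h' : x.obj = y.obj := funext fun i => by
    match i with
    | 0 => rw [← x.r_arr 0 1, h, y.r_arr]
    | 1 => rw [← x.s_arr 0 1, h, y.s_arr]
  have inv : ∀ z : Nerve G 1, z.arr 1 0 = G.inv (z.arr 0 1) := fun z =>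
    G.eq_inv_of_mul_eq_unit _ ((z.arr_mul 0 1 0).trans ((z.arr_self 0).trans
      (congrArg G.unit (z.r_arr 0 1).symm)))
  refine Nerve.ext h' (funext fun i => funext fun j => ?_)
  match i, j with
  | 0, 0 => rw [x.arr_self, y.arr_self, h']
  | 0, 1 => exact h
  | 1, 0 => rw [inv, inv, h]
  | 1, 1 => rw [x.arr_self, y.arr_self, h']

@[simp]
theorem obj_ofObj (x : G.Obj) : (ofObj x).obj 0 = x := G.r_unit x

theorem ρ_ofObj (x : G.Obj) : ρ (ofObj x) = ofObj (G.ρ₀ x) :=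
  ext_obj ((congrArg G.ρ₀ (obj_ofObj x)).trans (obj_ofObj _).symm)

@[simp]
theorem arr_ofArr (g : G.Arr) : (ofArr g).arr 0 1 = g := G.mul_inv_unit g (G.s g) _

theorem ofArr_arr (x : Nerve G 1) : ofArr (x.arr 0 1) = x := ext_arr (arr_ofArr _)

@[simp]
theorem obj_zero_ofArr (g : G.Arr) : (ofArr g).obj 0 = G.r g := rfl

@[simp]
theorem obj_one_ofArr (g : G.Arr) : (ofArr g).obj 1 = G.s g := G.r_unit _

theorem ρ_ofArr (g : G.Arr) : ρ (ofArr g) = ofArr (G.ρ g) :=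
  ext_arr ((congrArg G.ρ (arr_ofArr g)).trans (arr_ofArr _).symm)

theorem arr_one_two_ofPair (g h : G.Arr) (e : G.s g = G.r h) : (ofPair g h e).arr 1 2 = h :=
  G.mul_inv_unit h (G.s h) _

theorem arr_zero_two_ofPair (g h : G.Arr) (e : G.s g = G.r h) :
    (ofPair g h e).arr 0 2 = G.mul g h e :=
  G.mul_inv_unit (G.mul g h e) (G.s h) _

theorem arr_zero_one_ofPair (g h : G.Arr) (e : G.s g = G.r h) : (ofPair g h e).arr 0 1 = g :=
  G.mul_mul_inv g h e _

end Nerve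

end RealGroupoid

/-! ### Cochains as total functions -/

section

variable {G : RealGroupoid.{u}} {S : Type u} [Group S] [TopologicalSpace S] [RealGroup S]

open Classical in
/-- The value at `x` of a member of a cochain, extended by `1`. -/
noncomputable def PreSimplicialCover.eval (V : PreSimplicialCover G) {n : ℕ} (c : V.CR S n)
    (j : (V.cov n).J) (x : Nerve G n) : S :=
  -- A total function allows indices to be rewritten without transporting points of the domain. The
  -- value `1` outside the member plays no role: the identities below are asserted only under
  -- membership.
  if h : x ∈ (V.cov n).U j then c.1 j ⟨x, h⟩ else 1

theorem PreSimplicialCover.eval_of_mem (V : PreSimplicialCover G) {n : ℕ} (c : V.CR S n)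
    {j : (V.cov n).J} {x : Nerve G n} (h : x ∈ (V.cov n).U j) : V.eval c j x = c.1 j ⟨x, h⟩ :=
  dif_pos h

theorem PreSimplicialCover.eval_bar (V : PreSimplicialCover G) {n : ℕ} (c : V.CR S n)
    {j : (V.cov n).J} {x : Nerve G n} (h : x ∈ (V.cov n).U j) :
    V.eval c ((V.cov n).bar j) (Nerve.ρ x) = RealGroup.conj (V.eval c j x) := by
  rw [V.eval_of_mem c h, V.eval_of_mem c ((V.cov n).mem_bar h), c.2 j x h]

theorem PreSimplicialCover.continuousOn_eval (V : PreSimplicialCover G) {n : ℕ} (c : V.CR S n)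
    (j : (V.cov n).J) : ContinuousOn (V.eval c j) ((V.cov n).U j) := by
  rw [continuousOn_iff_continuous_domRestrict]
  exact (c.1 j).continuous.congr fun x => (V.eval_of_mem c x.2).symm

theorem PreSimplicialCover.eval_cocycle (V : PreSimplicialCover G) (c : V.ZR1 S)
    {j : (V.cov 2).J} {x : Nerve G 2} (h : x ∈ (V.cov 2).U j) :
    V.eval c.1 (V.face (ε 1) j) (Nerve.face (ε (n := 1) 1) x) =
      V.eval c.1 (V.face (ε 2) j) (Nerve.face (ε (n := 1) 2) x) *
      V.eval c.1 (V.face (ε 0) j) (Nerve.face (ε (n := 1) 0) x) := by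
  rw [V.eval_of_mem _ (V.face_mem (ε 1) j x h), V.eval_of_mem _ (V.face_mem (ε 2) j x h),
    V.eval_of_mem _ (V.face_mem (ε 0) j x h)]
  exact congrArg (fun f => f ⟨x, h⟩) (c.2 j)

end

/-! ### Members of `♮U`, and cocycles as functions of an arrow and two vertex indices -/

namespace NerveCover

open PreSimplicialCover (ε)

variable {G : RealGroupoid.{u}} (U : NerveCover G) {n : ℕ}

/-- The inclusion of the vertex `i`. -/
def vertexEmb (i : Fin (n + 1)) : Fin (0 + 1) ↪o Fin (n + 1) :=
  OrderEmbedding.ofStrictMono (fun _ => i) fun a b h => by omega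

theorem eq_vertexEmb (φ : Fin (0 + 1) ↪o Fin (n + 1)) : φ = vertexEmb (φ 0) :=
  RelEmbedding.ext fun i => by rw [Fin.fin_one_eq_zero i]; rfl

/-- An injective self-map of a finite set is onto, and strictly monotone maps on a finite chain with
the same range coincide. -/
theorem eq_refl_emb (φ : Fin (n + 1) ↪o Fin (n + 1)) : φ = RelEmbedding.refl _ :=
  RelEmbedding.ext fun i => congrFun (Finite.injective_iff_surjective.1 φ.injective |>
    fun h => (φ.strictMono.range_inj strictMono_id).1 (by rw [h.range_eq, range_id])) i

theorem le_of_emb {k : ℕ} (φ : Fin (k + 1) ↪o Fin (n + 1)) : k ≤ n := by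
  simpa using Fintype.card_le_of_injective φ φ.injective

variable {U}

/-- The index of the vertex `i`. -/
def vertex (l : (U.nat.cov n).J) (i : Fin (n + 1)) : (U 0).J := l 0 (vertexEmb i)

/-- The index of the edge of `[1]`. -/
def edge (l : (U.nat.cov 1).J) : (U 1).J := l 1 (RelEmbedding.refl _)

theorem nat_ext_zero {l l' : (U.nat.cov 0).J} (h : vertex l 0 = vertex l' 0) : l = l' := by
  funext k φ
  obtain rfl : k = 0 := Nat.le_zero.1 (le_of_emb φ)
  rw [eq_vertexEmb φ, Fin.fin_one_eq_zero (φ 0)]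
  exact h

/-- The only strictly increasing maps into `[1]` are its two vertices and the identity, so an
element of `Λ_1` has exactly these three components. -/
theorem nat_ext_one {l l' : (U.nat.cov 1).J} (h0 : vertex l 0 = vertex l' 0)
    (h1 : vertex l 1 = vertex l' 1) (h : edge l = edge l') : l = l' := by
  funext k φ
  match k with
  | 0 =>
    rw [eq_vertexEmb φ]
    match φ 0 with
    | 0 => exact h0
    | 1 => exact h1
  | 1 => rw [eq_refl_emb φ]; exact h
  | k + 2 => exact absurd (le_of_emb φ) (by omega)

theorem vertex_mem {l : (U.nat.cov n).J} {x : Nerve G n} (hx : x ∈ (U.nat.cov n).U l)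
    (i : Fin (n + 1)) : Nerve.ofObj (x.obj i) ∈ (U 0).U (vertex l i) := by
  have : Nerve.ofObj (x.obj i) = Nerve.face (vertexEmb i) x := Nerve.ext_obj (Nerve.obj_ofObj _)
  rw [this]
  exact hx 0 (vertexEmb i)

variable (U)

/-- The element of `Λ_n` with vertices `a` and edges `j`, whose higher members are chosen in
such a way that they contain `x`. -/
noncomputable def natIndex (x : Nerve G n) (a : Fin (n + 1) → (U 0).J)
    (j : Fin (n + 1) → Fin (n + 1) → (U 1).J) : (U.nat.cov n).J := fun k φ =>
  match k, φ with
  | 0, φ => a (φ 0)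
  | 1, φ => j (φ 0) (φ 1)
  | k + 2, φ => ((U (k + 2)).exists_mem (Nerve.face φ x)).choose

variable {U}

theorem mem_natIndex {x : Nerve G n} {a : Fin (n + 1) → (U 0).J}
    {j : Fin (n + 1) → Fin (n + 1) → (U 1).J} (ha : ∀ i, Nerve.ofObj (x.obj i) ∈ (U 0).U (a i))
    (hj : ∀ i k, i < k → Nerve.ofArr (x.arr i k) ∈ (U 1).U (j i k)) :
    x ∈ (U.nat.cov n).U (U.natIndex x a j) := fun k φ =>
  match k, φ with
  | 0, φ => by
    have : Nerve.face φ x = Nerve.ofObj (x.obj (φ 0)) := Nerve.ext_obj (Nerve.obj_ofObj _).symm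
    rw [this]
    exact ha _
  | 1, φ => by
    have : Nerve.face φ x = Nerve.ofArr (x.arr (φ 0) (φ 1)) :=
      Nerve.ext_arr (Nerve.arr_ofArr _).symm
    rw [this]
    exact hj _ _ (φ.strictMono Fin.zero_lt_one)
  | k + 2, φ => ((U (k + 2)).exists_mem (Nerve.face φ x)).choose_spec

variable (U) in
/-- The set of units covered by the member `a` of the cover in degree `0`. -/
def base (a : (U 0).J) : Set G.Obj := {x | Nerve.ofObj x ∈ (U 0).U a}

theorem isOpen_base (a : (U 0).J) : IsOpen (U.base a) :=
  ((U 0).isOpen_U a).preimage Nerve.continuous_ofObj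

theorem exists_mem_base (x : G.Obj) : ∃ a, x ∈ U.base a := (U 0).exists_mem (Nerve.ofObj x)

theorem mem_base_bar {a : (U 0).J} {x : G.Obj} (hx : x ∈ U.base a) :
    G.ρ₀ x ∈ U.base ((U 0).bar a) := by
  have := (U 0).mem_bar hx
  rwa [Nerve.ρ_ofObj] at this

variable (U) in
/-- An element of `Λ_1` with vertices `a`, `b` that contains the arrow `g`. -/
noncomputable def arrIndex (a b : (U 0).J) (g : G.Arr) : (U.nat.cov 1).J :=
  U.natIndex (Nerve.ofArr g) ![a, b] fun _ _ => ((U 1).exists_mem (Nerve.ofArr g)).choose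

theorem mem_arrIndex {a b : (U 0).J} {g : G.Arr} (ha : G.r g ∈ U.base a) (hb : G.s g ∈ U.base b) :
    Nerve.ofArr g ∈ (U.nat.cov 1).U (U.arrIndex a b g) := by
  refine mem_natIndex (fun i => ?_) fun i k h => ?_
  · match i with
    | 0 => exact ha
    | 1 => rw [Nerve.obj_one_ofArr]; exact hb
  · obtain ⟨rfl, rfl⟩ : i = 0 ∧ k = 1 := by
      rw [Fin.lt_def] at h; constructor <;> ext <;> simp <;> omega
    rw [Nerve.arr_ofArr]
    exact ((U 1).exists_mem (Nerve.ofArr g)).choose_spec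

variable {S : Type u} [Group S] [TopologicalSpace S] [RealGroup S]

/-- The cocycle identity is given on members in degree 2. Three edges whose vertices match bound
such a member around `(g, h)`, since its 2-cell index may be any index whose set contains the pair;
the edge indices of `l`, `m` and `k` are unrelated. -/
theorem eval_mul (c : U.nat.ZR1 S) {l m k : (U.nat.cov 1).J} {g h : G.Arr} (e : G.s g = G.r h)
    (hg : Nerve.ofArr g ∈ (U.nat.cov 1).U l) (hh : Nerve.ofArr h ∈ (U.nat.cov 1).U m)
    (hgh : Nerve.ofArr (G.mul g h e) ∈ (U.nat.cov 1).U k) (h0 : vertex k 0 = vertex l 0)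
    (h1 : vertex l 1 = vertex m 0) (h2 : vertex k 1 = vertex m 1) :
    U.nat.eval c.1 k (Nerve.ofArr (G.mul g h e)) =
      U.nat.eval c.1 l (Nerve.ofArr g) * U.nat.eval c.1 m (Nerve.ofArr h) := by
  set y := Nerve.ofPair g h e
  have f1 : Nerve.face (ε (n := 1) 1) y = Nerve.ofArr (G.mul g h e) :=
    Nerve.ext_arr ((Nerve.arr_zero_two_ofPair g h e).trans (Nerve.arr_ofArr _).symm)
  have f2 : Nerve.face (ε (n := 1) 2) y = Nerve.ofArr g :=
    Nerve.ext_arr ((Nerve.arr_zero_one_ofPair g h e).trans (Nerve.arr_ofArr _).symm)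
  have f0 : Nerve.face (ε (n := 1) 0) y = Nerve.ofArr h :=
    Nerve.ext_arr ((Nerve.arr_one_two_ofPair g h e).trans (Nerve.arr_ofArr _).symm)
  have edge_mem : ∀ {x : Nerve G 1} {l}, x ∈ (U.nat.cov 1).U l → x ∈ (U 1).U (edge l) :=
    fun hx => hx 1 (RelEmbedding.refl _)
  -- The edges `01`, `02`, `12` receive the indices of `l`, `k`, `m`; the entries on and below the
  -- diagonal are fillers.
  let p := U.natIndex y ![vertex l 0, vertex l 1, vertex m 1]
    ![![edge l, edge l, edge k], ![edge l, edge l, edge m], ![edge l, edge l, edge l]]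
  have hp : y ∈ (U.nat.cov 2).U p := by
    refine mem_natIndex (fun i => ?_) fun i j hij => ?_
    · match i with
      | 0 => 
        have := vertex_mem hg 0
        rwa [Nerve.obj_zero_ofArr, ← Nerve.arr_zero_one_ofPair g h e, Nerve.r_arr] at this
      | 1 =>
        have := vertex_mem hg 1
        rwa [Nerve.obj_one_ofArr, ← Nerve.arr_zero_one_ofPair g h e, Nerve.s_arr] at this
      | 2 =>
        have := vertex_mem hh 1
        rwa [Nerve.obj_one_ofArr, ← Nerve.arr_one_two_ofPair g h e, Nerve.s_arr] at this
    · have hij : (i = 0 ∧ j = 1) ∨ (i = 0 ∧ j = 2) ∨ (i = 1 ∧ j = 2) := by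
        revert i j; decide
      obtain ⟨rfl, rfl⟩ | ⟨rfl, rfl⟩ | ⟨rfl, rfl⟩ := hij
      · rw [Nerve.arr_zero_one_ofPair]; exact edge_mem hg
      · rw [Nerve.arr_zero_two_ofPair]; exact edge_mem hgh
      · rw [Nerve.arr_one_two_ofPair]; exact edge_mem hh
  have := U.nat.eval_cocycle c hp
  rw [f0, f1, f2] at this
  have p1 : U.nat.face (ε 1) p = k := nat_ext_one h0.symm h2.symm rfl
  have p2 : U.nat.face (ε 2) p = l := nat_ext_one rfl rfl rfl
  have p0 : U.nat.face (ε 0) p = m := nat_ext_one h1 rfl rfl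
  rwa [p0, p1, p2] at this

/-- The values of a cocycle depend only on the indices of the vertices. -/
theorem eval_eq (c : U.nat.ZR1 S) {l m : (U.nat.cov 1).J} {x : Nerve G 1}
    (hl : x ∈ (U.nat.cov 1).U l) (hm : x ∈ (U.nat.cov 1).U m) (h0 : vertex l 0 = vertex m 0)
    (h1 : vertex l 1 = vertex m 1) : U.nat.eval c.1 l x = U.nat.eval c.1 m x := by
  obtain ⟨g, rfl⟩ : ∃ g, x = Nerve.ofArr g := ⟨_, (Nerve.ofArr_arr x).symm⟩
  have hs : G.s g ∈ U.base (vertex m 1) := by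
    have := vertex_mem hm 1
    rwa [Nerve.obj_one_ofArr] at this
  have hu : Nerve.ofArr (G.unit (G.s g)) ∈
      (U.nat.cov 1).U (U.arrIndex (vertex m 1) (vertex m 1) (G.unit (G.s g))) :=
    mem_arrIndex (by rwa [G.r_unit]) (by rwa [G.s_unit])
  have e := (G.r_unit (G.s g)).symm
  -- Since `g = g · 1`, every index `k` with the vertices of `m` gives `c_k(g) = c_m(g) · c(1)`,
  -- where the right side does not involve `k`. Take `k = l` and `k = m`.
  have h := fun k hk => eval_mul c (k := k) e hm hu (by rw [G.mul_unit]; exact hk)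
  rw [G.mul_unit] at h
  rw [h l hl h0 rfl h1, ← h m hm rfl rfl rfl]

variable (c : U.nat.ZR1 S)

/-- The value of a cocycle at an arrow, for given indices of the range and the source. -/
noncomputable def arrEval (a b : (U 0).J) (g : G.Arr) : S :=
  U.nat.eval c.1 (U.arrIndex a b g) (Nerve.ofArr g)

theorem eval_eq_arrEval {l : (U.nat.cov 1).J} {x : Nerve G 1} (hl : x ∈ (U.nat.cov 1).U l) :
    U.nat.eval c.1 l x = arrEval c (vertex l 0) (vertex l 1) (x.arr 0 1) := by
  obtain ⟨g, rfl⟩ : ∃ g, x = Nerve.ofArr g := ⟨_, (Nerve.ofArr_arr x).symm⟩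
  have h1 := vertex_mem hl 1
  rw [Nerve.obj_one_ofArr] at h1
  rw [Nerve.arr_ofArr]
  exact eval_eq c hl (mem_arrIndex (vertex_mem hl 0) h1) rfl rfl

theorem arrEval_mul {a b d : (U 0).J} {g h : G.Arr} (e : G.s g = G.r h) (ha : G.r g ∈ U.base a)
    (hb : G.s g ∈ U.base b) (hd : G.s h ∈ U.base d) :
    arrEval c a d (G.mul g h e) = arrEval c a b g * arrEval c b d h :=
  eval_mul c e (mem_arrIndex ha hb) (mem_arrIndex (e ▸ hb) hd)
    (mem_arrIndex (by rwa [G.r_mul]) (by rwa [G.s_mul])) rfl rfl rfl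

theorem arrEval_bar {a b : (U 0).J} {g : G.Arr} (ha : G.r g ∈ U.base a) (hb : G.s g ∈ U.base b) :
    arrEval c ((U 0).bar a) ((U 0).bar b) (G.ρ g) = RealGroup.conj (arrEval c a b g) := by
  have h := mem_arrIndex ha hb
  have h' := (U.nat.cov 1).mem_bar h
  have := U.nat.eval_bar c.1 h
  rw [Nerve.ρ_ofArr] at h' this
  rw [eval_eq_arrEval c h', Nerve.arr_ofArr] at this
  exact this

/-- The edge index chosen by `arrIndex` varies with the arrow, without any continuity. Near `g`,
however, the member chosen at `g` still contains the arrow, and independence of the edge lets it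
compute all nearby values. -/
theorem continuousOn_arrEval (a b : (U 0).J) :
    ContinuousOn (arrEval c a b) (G.r ⁻¹' U.base a ∩ G.s ⁻¹' U.base b) := by
  rintro g ⟨ha, hb⟩
  have hg := mem_arrIndex ha hb
  have h1 := ((U.nat.continuousOn_eval c.1 _).continuousAt
    (((U.nat.cov 1).isOpen_U _).mem_nhds hg)).comp Nerve.continuous_ofArr.continuousAt
  refine (h1.congr ?_).continuousWithinAt
  filter_upwards [(((U.nat.cov 1).isOpen_U _).preimage Nerve.continuous_ofArr).mem_nhds hg]
    with g' hg'
  rw [Function.comp_apply, eval_eq_arrEval c hg', Nerve.arr_ofArr]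
  rfl

/-- A unit is idempotent, hence so is its value in the group `S`. -/
theorem arrEval_unit {a : (U 0).J} {x : G.Obj} (ha : x ∈ U.base a) :
    arrEval c a a (G.unit x) = 1 := by
  have h := arrEval_mul c (a := a) (b := a) (d := a) (g := G.unit x) (h := G.unit x)
    ((G.s_unit x).trans (G.r_unit x).symm) (by rwa [G.r_unit]) (by rwa [G.s_unit])
    (by rwa [G.s_unit])
  rw [G.unit_mul_unit] at h
  exact (mul_eq_left.1 h.symm)

end NerveCover

/-! ### The bundle with a given cocycle -/

namespace NerveCover

open PreSimplicialCover (ε)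
open RealGroupoid (ofGroup)

section

variable {G : RealGroupoid.{u}} {U : NerveCover G} {S : Type u} [Group S] [TopologicalSpace S]
  [RealGroup S] (c : U.nat.ZR1 S)

/-- Multiplication by a value at a unit changes the index of the source, and, in `arrEval_unit_mul`,
of the range. These two rules make all chart formulas below independent of the charts. -/
theorem arrEval_mul_unit {a b d : (U 0).J} {g : G.Arr} {x : G.Obj} (ha : G.r g ∈ U.base a)
    (hb : x ∈ U.base b) (hd : x ∈ U.base d) (hx : G.s g = x) :
    arrEval c a b g * arrEval c b d (G.unit x) = arrEval c a d g := by
  subst hx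
  rw [← arrEval_mul c (G.r_unit _).symm ha hb (by rwa [G.s_unit]), G.mul_unit]

theorem arrEval_unit_mul {a b d : (U 0).J} {g : G.Arr} {x : G.Obj} (ha : x ∈ U.base a)
    (hb : x ∈ U.base b) (hd : G.s g ∈ U.base d) (hx : G.r g = x) :
    arrEval c a b (G.unit x) * arrEval c b d g = arrEval c a d g := by
  subst hx
  rw [← arrEval_mul c (G.s_unit _) (by rwa [G.r_unit]) (by rwa [G.s_unit]) hd, G.unit_mul]

theorem continuousOn_arrEval_unit (a b : (U 0).J) :
    ContinuousOn (fun x => arrEval c a b (G.unit x)) (U.base a ∩ U.base b) :=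
  (continuousOn_arrEval c a b).comp G.continuous_unit.continuousOn fun x hx => by
    simpa [G.r_unit, G.s_unit] using hx

/-- The gluing data of the bundle with transition cocycle `c`. -/
noncomputable def bundleCore : FiberBundleCore (U 0).J G.Obj S where
  baseSet := U.base
  isOpen_baseSet := isOpen_base
  indexAt x := (exists_mem_base x).choose
  mem_baseSet_at x := (exists_mem_base x).choose_spec
  -- From `s_a = s_b · c_ba(1)`, the point `s_a · t` has coordinate `c_ba(1_x) t` in the chart `b`.
  -- Being left multiplications, the changes of chart commute with the right action of `S`.
  coordChange a b x t := arrEval c b a (G.unit x) * t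
  coordChange_self a x hx t := by rw [arrEval_unit c hx, one_mul]
  continuousOn_coordChange a b := by
    refine ContinuousOn.mul ?_ continuousOn_snd
    exact (continuousOn_arrEval_unit c b a).comp continuousOn_fst fun p hp => ⟨hp.1.2, hp.1.1⟩
  coordChange_comp a b d x hx t := by
    rw [← mul_assoc, arrEval_mul_unit c (by rw [G.r_unit]; exact hx.2) hx.1.2 hx.1.1 (G.s_unit x)]

/-- The total space of the bundle with transition cocycle `c`. -/
abbrev BundleSpace : Type u := (bundleCore c).TotalSpace

namespace BundleSpace

/-- An index of a chart around `x`. -/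
noncomputable abbrev index (x : G.Obj) : (U 0).J := (bundleCore c).indexAt x

theorem mem_index (x : G.Obj) : x ∈ U.base (index c x) := (bundleCore c).mem_baseSet_at x

/-- The point over `x` with coordinate `t` in the chart `a`. -/
noncomputable def pt (a : (U 0).J) (x : G.Obj) (t : S) : BundleSpace c :=
  ⟨x, (arrEval c (index c x) a (G.unit x) * t : S)⟩

variable {c}

/-- The coordinate of a point in the chart `a`. -/
noncomputable def coord (a : (U 0).J) (z : BundleSpace c) : S :=
  arrEval c a (index c z.1) (G.unit z.1) * (show S from z.2)

theorem pt_coord {a : (U 0).J} (z : BundleSpace c) (h : z.1 ∈ U.base a) :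
    pt c a z.1 (coord a z) = z := by
  obtain ⟨x, t⟩ := z
  refine congrArg (Bundle.TotalSpace.mk x) ?_
  rw [coord, ← mul_assoc, arrEval_mul_unit c (by rw [G.r_unit]; exact mem_index c x) h
    (mem_index c x) (G.s_unit x), arrEval_unit c (mem_index c x)]
  exact one_mul (M := S) t

theorem coord_pt {a b : (U 0).J} {x : G.Obj} (ha : x ∈ U.base a) (hb : x ∈ U.base b) (t : S) :
    coord a (pt c b x t) = arrEval c a b (G.unit x) * t := by
  show arrEval c a (index c x) (G.unit x) * (arrEval c (index c x) b (G.unit x) * t) = _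
  rw [← mul_assoc, arrEval_mul_unit c (by rwa [G.r_unit]) (mem_index c x) hb (G.s_unit x)]

theorem pt_eq {a b : (U 0).J} {x : G.Obj} (ha : x ∈ U.base a) (hb : x ∈ U.base b) (t : S) :
    pt c b x t = pt c a x (arrEval c a b (G.unit x) * t) := by
  rw [← coord_pt ha hb]
  exact (pt_coord (pt c b x t) ha).symm

/-- Every point has coordinates in some chart, so identities can be checked on `pt`, where the
structure maps have explicit formulas. -/
theorem ind {C : BundleSpace c → Prop} (h : ∀ a x (_ : x ∈ U.base a) t, C (pt c a x t))
    (z : BundleSpace c) : C z :=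
  pt_coord z (mem_index c z.1) ▸ h _ _ (mem_index c z.1) _

theorem continuousOn_pt (a : (U 0).J) :
    ContinuousOn (fun p : G.Obj × S => pt c a p.1 p.2) (U.base a ×ˢ univ) := by
  have := ((bundleCore c).localTriv a).toOpenPartialHomeomorph.symm.continuousOn
  rw [OpenPartialHomeomorph.symm_source, Bundle.Trivialization.target_eq] at this
  exact this

theorem continuousOn_coord (a : (U 0).J) :
    ContinuousOn (coord (c := c) a) (Bundle.TotalSpace.proj ⁻¹' U.base a) := by
  have := ((bundleCore c).localTriv a).continuousOn_toFun
  rw [Bundle.Trivialization.source_eq] at this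
  exact continuous_snd.comp_continuousOn this

theorem continuous_proj : Continuous fun z : BundleSpace c => z.1 := (bundleCore c).continuous_proj

theorem continuousAt_coord {T : Type*} [TopologicalSpace T] {f : T → BundleSpace c} {t₀ : T}
    (hf : ContinuousAt f t₀) {a : (U 0).J} (ha : (f t₀).1 ∈ U.base a) :
    ContinuousAt (fun t => coord a (f t)) t₀ :=
  ContinuousAt.comp (g := coord a) ((continuousOn_coord a).continuousAt
    (((isOpen_base a).preimage continuous_proj).mem_nhds ha)) hf

/-- The structure maps are defined with charts chosen pointwise, hence discontinuously. Continuity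
at a point follows once nearby values are expressed in one fixed chart. -/
theorem continuousAt_of_pt {T : Type*} [TopologicalSpace T] {f : T → BundleSpace c} {t₀ : T}
    {a : (U 0).J} {x : T → G.Obj} {t : T → S} (hx : ContinuousAt x t₀) (ht : ContinuousAt t t₀)
    (ha : x t₀ ∈ U.base a) (hf : ∀ᶠ y in 𝓝 t₀, f y = pt c a (x y) (t y)) : ContinuousAt f t₀ := by
  have h1 : ContinuousAt (fun p : G.Obj × S => pt c a p.1 p.2) (x t₀, t t₀) :=
    (continuousOn_pt a).continuousAt (((isOpen_base a).prod isOpen_univ).mem_nhds ⟨ha, mem_univ _⟩)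
  exact (ContinuousAt.comp (f := fun y => (x y, t y)) h1 (hx.prodMk ht)).congr
    (hf.mono fun y hy => hy.symm)

variable (c) in
/-- The Real structure. -/
noncomputable def τ (z : BundleSpace c) : BundleSpace c :=
  pt c ((U 0).bar (index c z.1)) (G.ρ₀ z.1) (RealGroup.conj (show S from z.2))

theorem arrEval_bar_unit {a b : (U 0).J} {x : G.Obj} (ha : x ∈ U.base a) (hb : x ∈ U.base b) :
    arrEval c ((U 0).bar a) ((U 0).bar b) (G.unit (G.ρ₀ x)) =
      RealGroup.conj (arrEval c a b (G.unit x)) := by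
  rw [← arrEval_bar c (by rwa [G.r_unit]) (by rwa [G.s_unit]), G.ρ_unit]

/-- The formula holds in every chart because the cocycle is Real: the change of chart from `a` to
`b` is conjugate to the one from `ā` to `b̄`. -/
theorem τ_pt {a : (U 0).J} {x : G.Obj} (ha : x ∈ U.base a) (t : S) :
    τ c (pt c a x t) = pt c ((U 0).bar a) (G.ρ₀ x) (RealGroup.conj t) := by
  have hi := mem_index c x
  rw [pt_eq (mem_base_bar hi) (mem_base_bar ha), arrEval_bar_unit hi ha, ← map_mul]
  rfl

/-- The left action of the groupoid. -/
noncomputable def lact (γ : G.Arr) (z : BundleSpace c) : BundleSpace c :=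
  pt c (index c (G.r γ)) (G.r γ) (arrEval c (index c (G.r γ)) (index c z.1) γ * (show S from z.2))

/-- The charts at both ends are arbitrary, since changing them multiplies `c(γ)` on either side by
values at units. -/
theorem lact_pt {a b : (U 0).J} {γ : G.Arr} {x : G.Obj} (hx : G.s γ = x) (ha : x ∈ U.base a)
    (hb : G.r γ ∈ U.base b) (t : S) :
    lact γ (pt c a x t) = pt c b (G.r γ) (arrEval c b a γ * t) := by
  subst hx
  have hi := mem_index c (G.s γ)
  have hj := mem_index c (G.r γ)
  show pt c _ _ (arrEval c _ (index c (G.s γ)) γ *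
    (arrEval c (index c (G.s γ)) a (G.unit (G.s γ)) * t)) = _
  rw [← mul_assoc, arrEval_mul_unit c hj hi ha rfl, pt_eq hb hj, ← mul_assoc,
    arrEval_unit_mul c hb hj ha rfl]

/-- The right action of the group. -/
noncomputable def act (z : BundleSpace c) (t : S) : BundleSpace c :=
  ⟨z.1, ((show S from z.2) * t : S)⟩

theorem act_pt (a : (U 0).J) (x : G.Obj) (t t' : S) : act (pt c a x t) t' = pt c a x (t * t') :=
  congrArg (Bundle.TotalSpace.mk x) (mul_assoc (G := S) _ t t')

theorem τ_act (z : BundleSpace c) (t : S) : τ c (act z t) = act (τ c z) (RealGroup.conj t) := by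
  induction z using ind with | _ a x ha t'
  rw [act_pt, τ_pt ha, τ_pt ha, map_mul, act_pt]

theorem lact_act (γ : G.Arr) (z : BundleSpace c) (t : S) (e : G.s γ = z.1) :
    lact γ (act z t) = act (lact γ z) t := by
  induction z using ind with | _ a x ha t'
  have e : G.s γ = x := e
  have h1 := mem_index c (G.r γ)
  rw [act_pt, lact_pt e ha h1, lact_pt e ha h1, act_pt, mul_assoc]

theorem unit_lact (z : BundleSpace c) : lact (G.unit z.1) z = z := by
  induction z using ind with | _ a x ha t
  show lact (G.unit x) _ = _
  rw [lact_pt (G.s_unit x) ha (b := a) (by rw [G.r_unit]; exact ha), arrEval_unit c ha, one_mul,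
    G.r_unit]

theorem continuous_τ : Continuous (τ c) := by
  refine continuous_iff_continuousAt.2 fun z => ?_
  have hz := mem_index c z.1
  have ha := mem_base_bar hz
  refine continuousAt_of_pt (x := fun z => G.ρ₀ z.1)
    (t := fun z => RealGroup.conj (coord (index c _) z))
    (G.continuous_ρ₀.comp continuous_proj).continuousAt
    (RealGroup.continuous_conj.continuousAt.comp (continuousAt_coord continuousAt_id hz)) ha ?_
  filter_upwards [((isOpen_base _).preimage continuous_proj).mem_nhds hz] with w hw
  rw [← τ_pt hw, pt_coord w hw]

theorem continuous_act : Continuous fun p : BundleSpace c × S => act p.1 p.2 := by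
  refine continuous_iff_continuousAt.2 fun ⟨z, t⟩ => ?_
  have hz := mem_index c z.1
  refine continuousAt_of_pt (x := fun p => p.1.1) (t := fun p => coord (index c z.1) p.1 * p.2)
    (continuous_proj.comp continuous_fst).continuousAt
    ((continuousAt_coord continuousAt_fst hz).mul continuousAt_snd) hz ?_
  filter_upwards [((isOpen_base _).preimage (continuous_proj.comp continuous_fst)).mem_nhds hz]
    with p hp
  rw [← act_pt, pt_coord p.1 hp]

theorem continuous_lact : Continuous fun p : {p : G.Arr × BundleSpace c // G.s p.1 = p.2.1} =>
    lact p.1.1 p.1.2 := by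
  refine continuous_iff_continuousAt.2 fun ⟨⟨γ, z⟩, e⟩ => ?_
  have hz := mem_index c z.1
  have hr := mem_index c (G.r γ)
  have c1 : Continuous fun p : {p : G.Arr × BundleSpace c // G.s p.1 = p.2.1} => p.1.1 := by
    fun_prop
  have c2 : Continuous fun p : {p : G.Arr × BundleSpace c // G.s p.1 = p.2.1} => p.1.2 := by
    fun_prop
  have e : G.s γ = z.1 := e
  -- The charts at `r(γ)` and at the base of `z` are kept fixed while the pair varies near `(γ, z)`.
  have c3 : ContinuousAt (arrEval c (index c (G.r γ)) (index c z.1)) γ :=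
    (continuousOn_arrEval c _ _).continuousAt ((((isOpen_base _).preimage G.continuous_r).inter
      ((isOpen_base _).preimage G.continuous_s)).mem_nhds ⟨hr, by rw [mem_preimage, e]; exact hz⟩)
  refine continuousAt_of_pt (x := fun p => G.r p.1.1)
    (t := fun p => arrEval c (index c (G.r γ)) (index c z.1) p.1.1 * coord (index c z.1) p.1.2)
    (G.continuous_r.comp c1).continuousAt
    (ContinuousAt.mul (ContinuousAt.comp (x := ⟨(γ, z), e⟩)
      (f := fun p : {p : G.Arr × BundleSpace c // G.s p.1 = p.2.1} => p.1.1)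
      (g := arrEval c (index c (G.r γ)) (index c z.1)) c3 c1.continuousAt)
      (continuousAt_coord c2.continuousAt hz)) hr ?_
  filter_upwards [((isOpen_base _).preimage (continuous_proj.comp c2)).mem_nhds hz,
    ((isOpen_base _).preimage (G.continuous_r.comp c1)).mem_nhds hr] with p hp hp'
  rw [← lact_pt p.2 hp hp', pt_coord p.1.2 hp]

/-- The continuous division map. -/
noncomputable def div (z w : BundleSpace c) : S := (show S from z.2)⁻¹ * (show S from w.2)

/-- A change of chart multiplies both coordinates on the left by the same element, which cancels in
the quotient. -/
theorem div_eq {a : (U 0).J} {z w : BundleSpace c} (h : z.1 = w.1) :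
    div z w = (coord a z)⁻¹ * coord a w := by
  obtain ⟨x, t⟩ := z
  obtain ⟨y, t'⟩ := w
  obtain rfl : x = y := h
  have key : ∀ u v w : S, u⁻¹ * v = (w * u)⁻¹ * (w * v) := fun u v w => by group
  exact key t t' _

theorem continuous_div : Continuous fun q : {q : BundleSpace c × BundleSpace c // q.1.1 = q.2.1} =>
    div q.1.1 q.1.2 := by
  refine continuous_iff_continuousAt.2 fun ⟨⟨z, w⟩, e⟩ => ?_
  have hz := mem_index c z.1
  have c1 : Continuous fun q : {q : BundleSpace c × BundleSpace c // q.1.1 = q.2.1} => q.1.1 := by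
    fun_prop
  have c2 : Continuous fun q : {q : BundleSpace c × BundleSpace c // q.1.1 = q.2.1} => q.1.2 := by
    fun_prop
  have e : z.1 = w.1 := e
  refine ContinuousAt.congr (f := fun q : {q : BundleSpace c × BundleSpace c // q.1.1 = q.2.1} =>
    (coord (index c z.1) q.1.1)⁻¹ * coord (index c z.1) q.1.2) ?_
    (Filter.Eventually.of_forall fun q => (div_eq q.2).symm)
  exact (continuousAt_coord c1.continuousAt hz).inv.mul
    (continuousAt_coord c2.continuousAt (show w.1 ∈ _ from e ▸ hz))

theorem act_div {z w : BundleSpace c} (h : z.1 = w.1) : act z (div z w) = w := by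
  obtain ⟨x, t⟩ := z
  obtain ⟨y, t'⟩ := w
  obtain rfl : x = y := h
  exact congrArg (Bundle.TotalSpace.mk x) (mul_inv_cancel_left (G := S) t t')

theorem div_act (z : BundleSpace c) (t : S) : div z (act z t) = t :=
  inv_mul_cancel_left (G := S) z.2 t

theorem act_one (z : BundleSpace c) : act z 1 = z :=
  congrArg (Bundle.TotalSpace.mk z.1) (mul_one (M := S) z.2)

instance : LocallyCompactSpace (BundleSpace c) :=
  ChartedSpace.locallyCompactSpace (G.Obj × S) (BundleSpace c)

/-- The pairs in a common fibre form a closed set, because `X` is Hausdorff, and the diagonal is the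
locus in it where the continuous division map equals `1`. -/
instance : T2Space (BundleSpace c) := by
  have hc : IsClosed {q : BundleSpace c × BundleSpace c | q.1.1 = q.2.1} :=
    isClosed_eq (continuous_proj.comp continuous_fst) (continuous_proj.comp continuous_snd)
  have h2 := hc.isClosedEmbedding_subtypeVal.isClosedMap _
    ((isClosed_singleton (x := (1 : S))).preimage continuous_div)
  rw [t2_iff_isClosed_diagonal]
  convert h2
  ext ⟨z, w⟩
  simp only [mem_diagonal_iff, mem_image, mem_preimage, mem_singleton_iff, Subtype.exists,
    exists_and_right, exists_eq_right]
  constructor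
  · rintro rfl
    exact ⟨rfl, inv_mul_cancel (G := S) z.2⟩
  · rintro ⟨h, hzw⟩
    have := act_div h
    rwa [hzw, act_one] at this

end BundleSpace

open BundleSpace

/-- The Real bibundle with transition cocycle `c`. -/
noncomputable def bibundle : RealBibundle G (ofGroup S) where
  Z := BundleSpace c
  τ := τ c
  continuous_τ := continuous_τ
  τ_τ := ind fun a x ha t => by
    rw [τ_pt ha, τ_pt (mem_base_bar ha), (U 0).bar_bar, G.ρ₀_ρ₀, RealGroup.conj_conj]
  rng z := z.1
  src _ := PUnit.unit
  continuous_rng := continuous_proj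
  isOpenMap_rng := (bundleCore c).isOpenMap_proj
  surjective_rng x := ⟨⟨x, (1 : S)⟩, rfl⟩
  continuous_src := continuous_const
  isOpenMap_src := fun O _ => isOpen_discrete (α := PUnit) _
  rng_τ _ := rfl
  src_τ _ := rfl
  lact γ z _ := lact γ z
  ract z t _ := act z t
  continuous_lact := continuous_lact
  continuous_ract := continuous_act.comp continuous_subtype_val
  rng_lact _ _ _ := rfl
  src_lact _ _ _ := rfl
  src_ract _ _ _ := rfl
  rng_ract _ _ _ := rfl
  unit_lact := BundleSpace.unit_lact
  ract_unit := BundleSpace.act_one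
  mul_lact γ γ' := ind fun a x ha t e e' => by
    have e' : G.s γ' = x := e'
    have h1 := mem_index c (G.r γ)
    have h2 := mem_index c (G.r γ')
    rw [lact_pt e' ha h2, lact_pt ((G.s_mul _ _ _).trans e') ha (by rw [G.r_mul]; exact h1),
      lact_pt e h2 h1, arrEval_mul c e h1 (by rw [e]; exact h2) (by rw [e']; exact ha), mul_assoc,
      G.r_mul]
  ract_mul z t t' _ _ := congrArg (Bundle.TotalSpace.mk z.1) (mul_assoc (G := S) z.2 t t').symm
  lact_ract γ z t e _ := BundleSpace.lact_act γ z t e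
  τ_lact γ := ind fun a x ha t e => by
    have e : G.s γ = x := e
    have h1 := mem_index c (G.r γ)
    have h2 := mem_base_bar h1
    rw [← G.r_ρ] at h2
    rw [lact_pt e ha h1, τ_pt h1, τ_pt ha,
      lact_pt ((G.s_ρ _).trans (congrArg _ e)) (mem_base_bar ha) h2, map_mul,
      arrEval_bar c h1 (by rw [e]; exact ha), G.r_ρ]
  τ_ract z t _ := BundleSpace.τ_act z t

/-- The Real generalized homomorphism with transition cocycle `c`. -/
noncomputable def genHom : RealGenHom G (ofGroup S) :=
  have h : (bibundle c).IsPrincipal := by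
    refine RealBibundle.isPrincipal_of_div _ (fun y => ?_) (fun q => div q.1.1 q.1.2)
      continuous_div (fun q => act_div q.2) (fun q t h => ?_)
    · refine ⟨U.base (index c y), isOpen_base _, mem_index c y,
        ⟨fun x => pt c (index c y) x 1, ?_⟩, fun _ => rfl⟩
      exact (continuousOn_pt _).comp_continuous
        (f := fun x : U.base (index c y) => ((x : G.Obj), (1 : S))) (by fun_prop)
        fun x => ⟨x.2, mem_univ _⟩
    · show div _ _ = t
      rw [← h]
      exact div_act _ _
  { toRealBibundle := bibundle c
    isPrincipal := h
    isLocallyTrivial := h.isLocallyTrivial }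

/-- The canonical local sections of the bundle with transition cocycle `c`. -/
noncomputable def genHomSection (l : (U.nat.cov 0).J) : C((U.nat.cov 0).U l, (genHom c).Z) where
  toFun x := pt c (vertex l 0) (x.1.obj 0) 1
  continuous_toFun := (continuousOn_pt _).comp_continuous
    (f := fun x : (U.nat.cov 0).U l => (x.1.obj 0, (1 : S)))
    (((Nerve.continuous_obj 0).comp continuous_subtype_val).prodMk continuous_const)
    fun x => ⟨vertex_mem x.2 0, mem_univ _⟩

/-- The section of index `a` has coordinate `1` in the chart `a`, so `g` sends it to a point with
coordinate `c(g) · 1 = 1 · c(g)`. -/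
theorem isTransition_genHom : (genHom c).IsTransition U.nat (genHomSection c) c where
  rng_s _ _ := rfl
  s_bar l x hx := by
    refine Eq.trans ?_ (τ_pt (vertex_mem hx 0) 1).symm
    rw [map_one]
    rfl
  lact_s l x hx e := by
    have h0 := vertex_mem hx 0
    have h1 := vertex_mem hx 1
    refine (lact_pt (b := vertex l 0) (x.s_arr 0 1) h1 (by rw [x.r_arr]; exact h0) 1).trans ?_
    refine Eq.trans ?_ (act_pt _ _ _ _).symm
    rw [x.r_arr, mul_one, one_mul, ← U.nat.eval_of_mem, eval_eq_arrEval c hx]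
    rfl

end

end NerveCover

/-! ### Transition cocycles and their cohomology class -/

namespace RealBibundle

theorem lact_congr {Γ G : RealGroupoid.{u}} (Z : RealBibundle Γ G) {γ γ' : Γ.Arr} {z z' : Z.Z}
    (hγ : γ = γ') (hz : z = z') (e : Γ.s γ = Z.rng z) (e' : Γ.s γ' = Z.rng z') :
    Z.lact γ z e = Z.lact γ' z' e' := by
  subst hγ hz; rfl

end RealBibundle

namespace RealGenHom

open PreSimplicialCover (ε)
open RealGroupoid (ofGroup)

variable {G : RealGroupoid.{u}} {S : Type u} [Group S] [TopologicalSpace S] [RealGroup S]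

/-- The division map of a principal bundle. -/
noncomputable def div (Z : RealGenHom G (ofGroup S)) :
    {q : Z.Z × Z.Z // Z.rng q.1 = Z.rng q.2} → S :=
  Z.isPrincipal.exists_divS.choose

section

variable (Z : RealGenHom G (ofGroup S))

theorem continuous_div : Continuous Z.div := Z.isPrincipal.exists_divS.choose_spec.1

theorem act_div {z w : Z.Z} (h : Z.rng z = Z.rng w) : Z.act z (Z.div ⟨(z, w), h⟩) = w :=
  Z.isPrincipal.exists_divS.choose_spec.2.1 ⟨(z, w), h⟩

theorem div_eq {z w : Z.Z} (h : Z.rng z = Z.rng w) {t : S} (ht : Z.act z t = w) :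
    Z.div ⟨(z, w), h⟩ = t :=
  Z.isPrincipal.exists_divS.choose_spec.2.2 ⟨(z, w), h⟩ t ht

theorem act_injective (z : Z.Z) {t t' : S} (h : Z.act z t = Z.act z t') : t = t' := by
  have hz : Z.rng z = Z.rng (Z.act z t') := (Z.rng_act z t').symm
  exact (Z.div_eq hz h).symm.trans (Z.div_eq hz rfl)

theorem section_congr {X J : Type u} [TopologicalSpace X] {Y : Type u} [TopologicalSpace Y]
    {A : J → Set X} (s : ∀ j, C(A j, Y)) {j j' : J} (hj : j = j') {x x' : X} (hx : x = x')
    (h : x ∈ A j) (h' : x' ∈ A j') : s j ⟨x, h⟩ = s j' ⟨x', h'⟩ := by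
  subst hj hx; rfl

end

namespace IsTransition

variable {Z Z' : RealGenHom G (ofGroup S)} {V W : PreSimplicialCover G}
  {s : ∀ j : (V.cov 0).J, C((V.cov 0).U j, Z.Z)} {s' : ∀ j : (V.cov 0).J, C((V.cov 0).U j, Z'.Z)}
  {c c' : V.ZR1 S}

/-- Transition cocycles restrict along refinements. -/
theorem refine (H : Z.IsTransition V s c) (θ : PreSimplicialCover.Refinement W V) :
    Z.IsTransition W (fun i => (s (θ.θ 0 i)).comp (ContinuousMap.inclusion (θ.subset 0 i)))
      (θ.cocycle c) where
  rng_s _ _ := H.rng_s _ _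
  s_bar i x hx := (section_congr s (θ.θ_bar 0 i) rfl _ _).trans (H.s_bar _ x (θ.subset 0 i hx))
  lact_s i x hx e := by
    have h := H.lact_s _ x (θ.subset 1 i hx)
    have h0 : s (θ.θ 0 (W.face (ε 0) i)) ⟨_, θ.subset 0 _ (W.face_mem (ε 0) i x hx)⟩ =
      s (V.face (ε 0) (θ.θ 1 i)) ⟨_, V.face_mem (ε 0) _ x (θ.subset 1 i hx)⟩ :=
      section_congr s (θ.θ_face (ε 0) i) rfl _ _
    have h1 : s (θ.θ 0 (W.face (ε 1) i)) ⟨_, θ.subset 0 _ (W.face_mem (ε 1) i x hx)⟩ =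
      s (V.face (ε 1) (θ.θ 1 i)) ⟨_, V.face_mem (ε 1) _ x (θ.subset 1 i hx)⟩ :=
      section_congr s (θ.θ_face (ε 1) i) rfl _ _
    refine (Z.lact_congr rfl h0 e (e.trans (congrArg Z.rng h0))).trans ((h _).trans ?_)
    exact congrArg (fun z => Z.act z (c.1.1 (θ.θ 1 i) ⟨x, θ.subset 1 i hx⟩)) h1.symm

/-- Transition cocycles are transported along isomorphisms. -/
theorem map (H : Z.IsTransition V s c) (i : Iso Z Z') :
    Z'.IsTransition V (fun j => (i.f : C(Z.Z, Z'.Z)).comp (s j)) c where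
  rng_s j x := (i.rng_f _).trans (H.rng_s j x)
  s_bar j x hx := (congrArg i.f (H.s_bar j x hx)).trans (i.τ_f _)
  lact_s j x hx e := (i.f_lact _ _ (e.trans (i.rng_f _))).symm.trans
    ((congrArg i.f (H.lact_s j x hx _)).trans (i.f_ract _ _ rfl))

/-- A cocycle that is cohomologous to a transition cocycle is a transition cocycle. -/
theorem of_equiv (H : Z.IsTransition V s c) (h : c ≈ c') : ∃ s', Z.IsTransition V s' c' := by
  obtain ⟨φ, h⟩ := h
  -- The new sections are `s_j φ_j`.
  refine ⟨fun j => ⟨fun x => Z.act (s j x) (φ.1 j x), Z.continuous_act.comp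
    (f := fun x => (s j x, φ.1 j x)) (by fun_prop)⟩, fun j x => ?_, fun j x hx => ?_,
    fun j x hx e => ?_⟩
  · exact (Z.rng_act _ _).trans (H.rng_s j x)
  · show Z.act (s _ _) (φ.1 _ _) = Z.τ (Z.act (s _ _) (φ.1 _ _))
    rw [H.s_bar j x hx, φ.2 j x hx, Z.τ_act]
  · have h1 := congrArg (fun f => f ⟨x, hx⟩) (h j)
    show Z.lact _ (Z.act _ _) _ = Z.act (Z.act _ _) _
    rw [Z.lact_act _ _ _ _ (e.trans (Z.rng_act _ _)), H.lact_s j x hx, Z.act_act, Z.act_act, h1]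
    congr 1
    simp [PreSimplicialCover.res, mul_assoc]

/-- Two transition cocycles over the same cover are cohomologous. -/
theorem equiv {s' : ∀ j : (V.cov 0).J, C((V.cov 0).U j, Z.Z)} (H : Z.IsTransition V s c)
    (H' : Z.IsTransition V s' c') : c ≈ c' := by
  have hr : ∀ j x, Z.rng (s j x) = Z.rng (s' j x) := fun j x =>
    (H.rng_s j x).trans (H'.rng_s j x).symm
  -- The cochain is `φ_j = s_j⁻¹ s'_j`, continuous because division is.
  refine ⟨⟨fun j => ⟨fun x => Z.div ⟨(s j x, s' j x), hr j x⟩,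
    Z.continuous_div.comp (Continuous.subtype_mk (by fun_prop) _)⟩, fun j x hx => ?_⟩, fun j => ?_⟩
  · refine Z.div_eq _ ?_
    rw [H.s_bar j x hx, H'.s_bar j x hx, ← Z.τ_act]
    exact congrArg Z.τ (Z.act_div (hr j ⟨x, hx⟩))
  · ext ⟨x, hx⟩
    have m0 := V.face_mem (ε 0) j x hx
    have m1 := V.face_mem (ε 1) j x hx
    have e : G.s (x.arr 0 1) = Z.rng (s _ ⟨_, m0⟩) := (x.s_arr 0 1).trans (H.rng_s _ ⟨_, m0⟩).symm
    have e' : G.s (x.arr 0 1) = Z.rng (s' _ ⟨_, m0⟩) := (x.s_arr 0 1).trans (H'.rng_s _ ⟨_, m0⟩).symm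
    have a0 := (Z.act_div (hr _ ⟨_, m0⟩))
    have a1 := (Z.act_div (hr _ ⟨_, m1⟩))
    have h := H.lact_s j x hx e
    have h' := H'.lact_s j x hx e'
    -- Both elements carry `s_{j₀}` to `g · s'_{j₁}`: one passes through `s'_{j₀} · c'`, the other
    -- through `(g · s_{j₁}) · φ`. Freeness of the action gives `φ c' = c φ`.
    have key := Z.act_injective (s _ ⟨_, m1⟩) (t := Z.div ⟨_, hr _ ⟨_, m1⟩⟩ * c'.1.1 j ⟨x, hx⟩)
      (t' := c.1.1 j ⟨x, hx⟩ * Z.div ⟨_, hr _ ⟨_, m0⟩⟩) (by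
        rw [← Z.act_act, ← Z.act_act, a1, ← h, ← h',
          ← Z.lact_act _ _ _ (e.trans (Z.rng_act _ _).symm)]
        exact Z.lact_congr rfl a0.symm _ _)
    exact (eq_inv_mul_iff_mul_eq.2 key).trans (mul_assoc _ _ _).symm

/-- The class of a transition cocycle depends only on the isomorphism class. -/
theorem mk_eq (i : Iso Z Z') {U U' : NerveCover.Adm G} {s s' c c'}
    (H : Z.IsTransition U.cov.nat s c) (H' : Z'.IsTransition U'.cov.nat s' c') :
    CechHR1.mk U c = CechHR1.mk U' c' := by
  -- Over the cover by intersections, both cocycles belong to the single bundle `Z'`.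
  have h1 := (H.map i).refine (NerveCover.prodFst U.cov U'.cov).nat
  have h2 := H'.refine (NerveCover.prodSnd U.cov U'.cov).nat
  refine (CechHR1.of_map (W := U.prod U') (NerveCover.prodFst U.cov U'.cov) _).symm.trans ?_
  refine Eq.trans ?_ (CechHR1.of_map (W := U.prod U') (NerveCover.prodSnd U.cov U'.cov) _)
  exact congrArg (CechHR1.of (U.prod U')) (Quotient.sound (h1.equiv h2))

end IsTransition

/-! ### Bundles with the same transition cocycle -/

section Iso

open NerveCover

variable {Z Z' : RealGenHom G (ofGroup S)} {U : NerveCover G}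
  {s : ∀ j : (U.nat.cov 0).J, C((U.nat.cov 0).U j, Z.Z)}
  {s' : ∀ j : (U.nat.cov 0).J, C((U.nat.cov 0).U j, Z'.Z)} {c : U.nat.ZR1 S}

theorem IsTransition.rng_ofObj (H : Z.IsTransition U.nat s c) {l x}
    (h : Nerve.ofObj x ∈ (U.nat.cov 0).U l) : Z.rng (s l ⟨Nerve.ofObj x, h⟩) = x :=
  (H.rng_s l _).trans (Nerve.obj_ofObj x)

/-- Any two indices around the ends of an arrow are the faces of a member containing that arrow, so
the transition relation holds for vertex indices chosen independently. -/
theorem IsTransition.lact_section (H : Z.IsTransition U.nat s c) {l m : (U.nat.cov 0).J} {γ : G.Arr}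
    {x y : G.Obj} (hγ : G.s γ = x) (hγ' : G.r γ = y) (hl : Nerve.ofObj y ∈ (U.nat.cov 0).U l)
    (hm : Nerve.ofObj x ∈ (U.nat.cov 0).U m) (e : G.s γ = Z.rng (s m ⟨Nerve.ofObj x, hm⟩)) :
    Z.lact γ (s m ⟨Nerve.ofObj x, hm⟩) e =
      Z.act (s l ⟨Nerve.ofObj y, hl⟩) (arrEval c (vertex l 0) (vertex m 0) γ) := by
  subst hγ hγ'
  have bl : G.r γ ∈ U.base (vertex l 0) := by
    have := vertex_mem hl 0
    rwa [Nerve.obj_ofObj] at this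
  have bm : G.s γ ∈ U.base (vertex m 0) := by
    have := vertex_mem hm 0
    rwa [Nerve.obj_ofObj] at this
  have hk := mem_arrIndex bl bm
  have l0 : m = U.nat.face (ε 0) (U.arrIndex (vertex l 0) (vertex m 0) γ) := nat_ext_zero rfl
  have l1 : l = U.nat.face (ε 1) (U.arrIndex (vertex l 0) (vertex m 0) γ) := nat_ext_zero rfl
  have x0 : Nerve.ofObj (G.s γ) = Nerve.face (ε (n := 0) 0) (Nerve.ofArr γ) := Nerve.ext_obj rfl
  have x1 : Nerve.ofObj (G.r γ) = Nerve.face (ε (n := 0) 1) (Nerve.ofArr γ) :=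
    Nerve.ext_obj (Nerve.obj_ofObj _)
  have e0 : s m ⟨Nerve.ofObj (G.s γ), hm⟩ = s (U.nat.face (ε 0) (U.arrIndex _ _ γ))
      ⟨_, U.nat.face_mem (ε 0) _ _ hk⟩ :=
    section_congr s l0 x0 _ _
  have e1 : s l ⟨Nerve.ofObj (G.r γ), hl⟩ = s (U.nat.face (ε 1) (U.arrIndex _ _ γ))
      ⟨_, U.nat.face_mem (ε 1) _ _ hk⟩ :=
    section_congr s l1 x1 _ _
  have e2 : G.s ((Nerve.ofArr γ).arr 0 1) = Z.rng (s (U.nat.face (ε 0) (U.arrIndex _ _ γ))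
      ⟨_, U.nat.face_mem (ε 0) _ _ hk⟩) := by
    rw [Nerve.arr_ofArr]; exact e.trans (congrArg Z.rng e0)
  refine (Z.lact_congr (Nerve.arr_ofArr γ).symm e0 e e2).trans ((H.lact_s _ _ hk e2).trans ?_)
  rw [← U.nat.eval_of_mem, eval_eq_arrEval c hk, Nerve.arr_ofArr, e1]
  rfl

/-- This is the transition relation at a unit arrow. -/
theorem IsTransition.section_eq (H : Z.IsTransition U.nat s c) {l m : (U.nat.cov 0).J} {x : G.Obj}
    (hl : Nerve.ofObj x ∈ (U.nat.cov 0).U l) (hm : Nerve.ofObj x ∈ (U.nat.cov 0).U m) :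
    s m ⟨Nerve.ofObj x, hm⟩ =
      Z.act (s l ⟨Nerve.ofObj x, hl⟩) (arrEval c (vertex l 0) (vertex m 0) (G.unit x)) := by
  have e := (H.rng_ofObj hm)
  rw [← H.lact_section (G.s_unit x) (G.r_unit x) hl hm ((G.s_unit x).trans e.symm)]
  exact (Z.unit_lact _).symm.trans (Z.lact_congr (congrArg G.unit e) rfl _ _)

/-- The rule `s_l(x) t ↦ s'_l(x) t` is consistent because, in both bundles, passing from the index
`l` to `m` multiplies the section by the same element `c_lm(1_x)`. -/
theorem IsTransition.exists_map (H : Z.IsTransition U.nat s c) (H' : Z'.IsTransition U.nat s' c) :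
    ∃ f : Z.Z → Z'.Z, Continuous f ∧ ∀ l x (h : Nerve.ofObj x ∈ (U.nat.cov 0).U l) t,
      f (Z.act (s l ⟨Nerve.ofObj x, h⟩) t) = Z'.act (s' l ⟨Nerve.ofObj x, h⟩) t := by
  choose l hl using fun x : G.Obj => (U.nat.cov 0).exists_mem (Nerve.ofObj x)
  have hr : ∀ l z (h : Nerve.ofObj (Z.rng z) ∈ (U.nat.cov 0).U l),
    Z.rng (s l ⟨Nerve.ofObj (Z.rng z), h⟩) = Z.rng z := fun l z h => H.rng_ofObj h
  let f : Z.Z → Z'.Z := fun z => Z'.act (s' (l (Z.rng z)) ⟨_, hl _⟩) (Z.div ⟨(_, z), hr _ z (hl _)⟩)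
  have hf : ∀ m x (h : Nerve.ofObj x ∈ (U.nat.cov 0).U m) t,
      f (Z.act (s m ⟨Nerve.ofObj x, h⟩) t) = Z'.act (s' m ⟨Nerve.ofObj x, h⟩) t := by
    intro m x h t
    have hz : Z.rng (Z.act (s m ⟨Nerve.ofObj x, h⟩) t) = x := (Z.rng_act _ _).trans (H.rng_ofObj h)
    generalize hw : Z.act (s m ⟨Nerve.ofObj x, h⟩) t = w at hz
    subst hz
    rw [H.section_eq (hl _) h, Z.act_act] at hw
    rw [H'.section_eq (hl _) h, Z'.act_act, ← Z.div_eq (hr _ w (hl _)) hw]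
  refine ⟨f, continuous_iff_continuousAt.2 fun z => ?_, hf⟩
  -- The index used by `f` jumps with the point. On this neighbourhood of `z` the index chosen at
  -- `z` serves for all points, and there `f` is a composite of continuous maps.
  let O := {w : Z.Z | Nerve.ofObj (Z.rng w) ∈ (U.nat.cov 0).U (l (Z.rng z))}
  have hO : IsOpen O :=
    ((U.nat.cov 0).isOpen_U _).preimage (Nerve.continuous_ofObj.comp Z.continuous_rng)
  refine ContinuousOn.continuousAt (s := O) ?_ (hO.mem_nhds (hl _))
  rw [continuousOn_iff_continuous_domRestrict]
  have c0 : Continuous fun w : O => Nerve.ofObj (Z.rng w) :=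
    Nerve.continuous_ofObj.comp (Z.continuous_rng.comp continuous_subtype_val)
  have c1 : Continuous fun w : O => s (l (Z.rng z)) ⟨Nerve.ofObj (Z.rng w), w.2⟩ :=
    (s _).continuous.comp (c0.subtype_mk _)
  have c2 : Continuous fun w : O => s' (l (Z.rng z)) ⟨Nerve.ofObj (Z.rng w), w.2⟩ :=
    (s' _).continuous.comp (c0.subtype_mk _)
  refine (Z'.continuous_act.comp (f := fun w : O => (s' (l (Z.rng z)) ⟨Nerve.ofObj (Z.rng w), w.2⟩,
    Z.div ⟨(s (l (Z.rng z)) ⟨Nerve.ofObj (Z.rng w), w.2⟩, (w : Z.Z)), hr _ w w.2⟩))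
    (c2.prodMk (Z.continuous_div.comp ((c1.prodMk continuous_subtype_val).subtype_mk _)))).congr
    fun w => ?_
  rw [Function.comp_apply, ← hf, Z.act_div]
  rfl

/-- Every point is a translate of the value of a section. -/
theorem IsTransition.ind (H : Z.IsTransition U.nat s c) {C : Z.Z → Prop}
    (h : ∀ l x (h : Nerve.ofObj x ∈ (U.nat.cov 0).U l) t, C (Z.act (s l ⟨Nerve.ofObj x, h⟩) t))
    (z : Z.Z) : C z := by
  obtain ⟨l, hl⟩ := (U.nat.cov 0).exists_mem (Nerve.ofObj (Z.rng z))
  have := h l _ hl (Z.div ⟨(_, z), H.rng_ofObj hl⟩)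
  rwa [Z.act_div] at this

/-- Real generalized homomorphisms with the same transition cocycle are isomorphic. -/
theorem IsTransition.nonempty_iso (H : Z.IsTransition U.nat s c)
    (H' : Z'.IsTransition U.nat s' c) : Nonempty (Iso Z Z') := by
  obtain ⟨f, hf, h⟩ := H.exists_map H'
  obtain ⟨f', hf', h'⟩ := H'.exists_map H
  have hr : ∀ z, Z'.rng (f z) = Z.rng z := H.ind fun l x hx t => by
    rw [h, Z.rng_act, Z'.rng_act, H.rng_ofObj, H'.rng_ofObj]
  refine ⟨{
    f := ⟨⟨f, f', H.ind fun l x hx t => by rw [h, h'], H'.ind fun l x hx t => by rw [h', h]⟩, hf, hf'⟩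
    rng_f := hr
    src_f := fun _ => rfl
    τ_f := H.ind fun l x hx t => ?_
    f_lact := fun γ => H.ind fun l x hx t e => ?_
    f_ract := H.ind fun l x hx t (t' : S) _ => ?_ }⟩
  · show f _ = Z'.τ (f _)
    have hx' := (U.nat.cov 0).mem_bar hx
    have e := H.s_bar l _ hx
    have e' := H'.s_bar l _ hx
    simp only [Nerve.ρ_ofObj] at hx' e e'
    rw [h, Z.τ_act, Z'.τ_act, ← e, ← e', h]
  · show f _ = Z'.lact γ (f _) _
    have e0 : G.s γ = x := e.trans ((Z.rng_act _ _).trans (H.rng_ofObj hx))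
    -- An index around `r(γ)` lets `γ` be replaced on both sides by right multiplication by the same
    -- value of `c`, which `f` respects.
    obtain ⟨m, hm⟩ := (U.nat.cov 0).exists_mem (Nerve.ofObj (G.r γ))
    rw [Z.lact_act _ _ _ _ (e0.trans (H.rng_ofObj hx).symm), H.lact_section e0 rfl hm hx,
      Z.act_act, h, ← Z'.act_act, ← H'.lact_section e0 rfl hm hx (e0.trans (H'.rng_ofObj hx).symm),
      ← Z'.lact_act _ _ _ (e0.trans ((Z'.rng_act _ _).trans (H'.rng_ofObj hx)).symm)]
    exact Z'.lact_congr rfl (h l x hx t).symm _ _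
  · show f (Z.act (Z.act _ _) t') = Z'.act (f _) t'
    rw [Z.act_act, h, h, Z'.act_act]

end Iso

end RealGenHom

/-! ### Existence of transition cocycles -/

namespace NerveCover

variable {G : RealGroupoid.{u}}

/-- The cover of the nerve, indexed by families of indices of the vertices, that is defined by a
Real cover of the space of units. -/
def ofBase (B : RealCover G.Obj G.ρ₀) : NerveCover G := fun n =>
  { J := Fin (n + 1) → B.J
    bar := fun j i => B.bar (j i)
    bar_bar := fun j => funext fun i => B.bar_bar _
    U := fun j => {x | ∀ i, x.obj i ∈ B.U (j i)}
    isOpen_U := fun j => by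
      rw [ofPred_forall]
      exact isOpen_iInter_of_finite fun i => (B.isOpen_U (j i)).preimage (Nerve.continuous_obj i)
    exists_mem := fun x => ⟨fun i => (B.exists_mem (x.obj i)).choose,
      fun i => (B.exists_mem (x.obj i)).choose_spec⟩
    U_bar := fun j => by
      have key : ∀ (j : Fin (n + 1) → B.J) (x : Nerve G n), (∀ i, x.obj i ∈ B.U (j i)) →
          ∀ i, (Nerve.ρ x).obj i ∈ B.U (B.bar (j i)) := fun j x h i => B.mem_bar (h i)
      ext x
      constructor
      · intro h
        refine ⟨Nerve.ρ x, fun i => ?_, Nerve.ρ_ρ x⟩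
        have := key _ x h i
        rwa [B.bar_bar] at this
      · rintro ⟨y, hy, rfl⟩
        exact key j y hy }

/-- An index is a function on vertices, so every map of vertices acts by precomposition, in all
degrees. -/
theorem hasSimplicialStructure_ofBase (B : RealCover G.Obj G.ρ₀) (N : ℕ) :
    (ofBase B).HasSimplicialStructure N :=
  ⟨fun _ _ f j i => j (f i), fun _ _ => rfl, fun _ _ _ _ _ _ => rfl, fun _ _ _ _ => rfl,
    fun _ _ f _ _ hx i => hx (f i)⟩

end NerveCover

namespace RealGenHom

open PreSimplicialCover (ε)
open RealGroupoid (ofGroup)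
open NerveCover

section Group

variable {G : RealGroupoid.{u}} {S : Type u} [Group S] [TopologicalSpace S] [RealGroup S]

/-- A local section over `A` and its conjugate `τ ∘ σ ∘ ρ₀` over `ρ₀⁻¹(A)` are given different
indices, exchanged by the involution. No index is fixed, so no local section has to be invariant
under the Real structure. -/
theorem exists_realCover (Z : RealGenHom G (ofGroup S)) :
    ∃ (B : RealCover G.Obj G.ρ₀) (σ : ∀ b, C(B.U b, Z.Z)), (∀ b x, Z.rng (σ b x) = x) ∧
      ∀ b x (hx : x ∈ B.U b), σ (B.bar b) ⟨G.ρ₀ x, B.mem_bar hx⟩ = Z.τ (σ b ⟨x, hx⟩) := by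
  choose A hA hy σ hσ using Z.isPrincipal.1
  let D : G.Obj × Bool → Set G.Obj := fun b => bif b.2 then A b.1 else G.ρ₀ ⁻¹' A b.1
  let τσ : ∀ b, C(D b, Z.Z) := fun b => match b with
    | (y, true) => σ y
    | (y, false) => ⟨fun x => Z.τ (σ y ⟨G.ρ₀ x, x.2⟩), Z.continuous_τ.comp
        ((σ y).continuous.comp ((G.continuous_ρ₀.comp continuous_subtype_val).subtype_mk _))⟩
  have hD : ∀ b x, x ∈ D b → G.ρ₀ x ∈ D (b.1, !b.2) := fun b x hx => match b, hx with
    | (y, true), hx => show G.ρ₀ (G.ρ₀ x) ∈ A y by rw [G.ρ₀_ρ₀]; exact hx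
    | (y, false), hx => hx
  let B : RealCover G.Obj G.ρ₀ :=
    { J := G.Obj × Bool
      bar := fun b => (b.1, !b.2)
      bar_bar := fun b => by simp
      U := D
      isOpen_U := fun b => match b with
        | (y, true) => hA y
        | (y, false) => (hA y).preimage G.continuous_ρ₀
      exists_mem := fun x => ⟨(x, true), hy x⟩
      U_bar := fun b => by
        ext x
        constructor
        · intro hx
          have := hD _ x hx
          rw [Bool.not_not] at this
          exact ⟨G.ρ₀ x, this, G.ρ₀_ρ₀ x⟩
        · rintro ⟨y, hy, rfl⟩
          exact hD b y hy }
  refine ⟨B, τσ, fun b x => ?_, fun b x hx => ?_⟩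
  · match b, x with
    | (y, true), x => exact hσ y x
    | (y, false), x =>
      refine (Z.rng_τ _).trans ?_
      rw [hσ, G.ρ₀_ρ₀]
  · match b, hx with
    | (y, true), hx =>
      -- Conjugating a section of type `true` evaluates it at `ρ₀(ρ₀ x) = x`; for type `false` the
      -- claim is that `τ` is an involution.
      refine congrArg Z.τ (section_congr σ rfl (G.ρ₀_ρ₀ x) _ _)
    | (y, false), hx => exact (Z.τ_τ _).symm

/-- Dividing `g · σ_b(s(g))` by `σ_a(r(g))` in the fibre over `r(g)` gives the cocycle. Its
continuity, reality and cocycle identity come from continuity and uniqueness of the division. -/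
theorem exists_isTransition_of_base (Z : RealGenHom G (ofGroup S)) (U : NerveCover G)
    (σ : ∀ a, C(U.base a, Z.Z)) (hσ : ∀ a x, Z.rng (σ a x) = x)
    (hbar : ∀ a x (hx : x ∈ U.base a), σ ((U 0).bar a) ⟨G.ρ₀ x, mem_base_bar hx⟩ = Z.τ (σ a ⟨x, hx⟩)) :
    ∃ s c, Z.IsTransition U.nat s c := by
  have e : ∀ (l : (U.nat.cov 1).J) x (hx : x ∈ (U.nat.cov 1).U l),
      G.s (x.arr 0 1) = Z.rng (σ (vertex l 1) ⟨x.obj 1, vertex_mem hx 1⟩) :=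
    fun l x hx => (x.s_arr 0 1).trans (hσ _ ⟨x.obj 1, vertex_mem hx 1⟩).symm
  have hr : ∀ (l : (U.nat.cov 1).J) x (hx : x ∈ (U.nat.cov 1).U l),
      Z.rng (σ (vertex l 0) ⟨x.obj 0, vertex_mem hx 0⟩) = Z.rng (Z.lact (x.arr 0 1) _ (e l x hx)) :=
    fun l x hx => by rw [Z.rng_lact, hσ, x.r_arr]
  let c : ∀ l : (U.nat.cov 1).J, C((U.nat.cov 1).U l, S) := fun l =>
    ⟨fun x => Z.div ⟨(_, _), hr l x.1 x.2⟩, Z.continuous_div.comp (Continuous.subtype_mk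
      (Continuous.prodMk ((σ _).continuous.comp (Continuous.subtype_mk
        ((Nerve.continuous_obj 0).comp continuous_subtype_val) _))
        (Z.continuous_lact.comp (f := fun x : (U.nat.cov 1).U l =>
          (⟨(x.1.arr 0 1, σ (vertex l 1) ⟨x.1.obj 1, vertex_mem x.2 1⟩), e l x.1 x.2⟩ :
            {p : G.Arr × Z.Z // G.s p.1 = Z.rng p.2}))
          (Continuous.subtype_mk (Continuous.prodMk
            ((Nerve.continuous_arr 0 1).comp continuous_subtype_val)
            ((σ _).continuous.comp (Continuous.subtype_mk
              ((Nerve.continuous_obj 1).comp continuous_subtype_val) _))) _))) _)⟩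
  have hc : ∀ l x (hx : x ∈ (U.nat.cov 1).U l),
      Z.act (σ (vertex l 0) ⟨x.obj 0, vertex_mem hx 0⟩) (c l ⟨x, hx⟩) =
        Z.lact (x.arr 0 1) (σ (vertex l 1) ⟨x.obj 1, vertex_mem hx 1⟩) (e l x hx) :=
    fun l x hx => Z.act_div (hr l x hx)
  -- By uniqueness of the quotient it suffices to apply `τ` to the defining relation.
  have hreal : c ∈ U.nat.CR S 1 := fun l x hx => by
    refine Z.div_eq _ ?_
    have h0 := hbar (vertex l 0) (x.obj 0) (vertex_mem hx 0)
    have h1 := hbar (vertex l 1) (x.obj 1) (vertex_mem hx 1)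
    refine (congrArg (fun z => Z.act z _) h0).trans ?_
    rw [← Z.τ_act, hc, Z.τ_lact]
    exact Z.lact_congr rfl h1.symm _ _
  refine ⟨fun l => (σ (vertex l 0)).comp ⟨fun x => ⟨x.1.obj 0, vertex_mem x.2 0⟩,
    ((Nerve.continuous_obj 0).comp continuous_subtype_val).subtype_mk _⟩,
    ⟨⟨c, hreal⟩, fun l => ?_⟩, fun l x => hσ _ _, fun l x hx => hbar _ _ (vertex_mem hx 0),
    fun l x hx _ => (hc l x hx).symm⟩
  ext ⟨x, hx⟩
  refine Z.div_eq _ ?_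
  have m0 := U.nat.face_mem (ε 0) l x hx
  have m2 := U.nat.face_mem (ε 2) l x hx
  have h0 := hc _ _ m0
  have h2 := hc _ _ m2
  have e1 : G.s (x.arr 1 2) = Z.rng (σ (vertex l 2) ⟨x.obj 2, vertex_mem hx 2⟩) :=
    (x.s_arr 1 2).trans (hσ _ ⟨x.obj 2, vertex_mem hx 2⟩).symm
  have e2 : G.s (x.arr 0 1) = G.r (x.arr 1 2) := (x.s_arr 0 1).trans (x.r_arr 1 2).symm
  -- With `g`, `h` the two arrows: `σ₀ c(g) c(h) = (g σ₁) c(h) = g (σ₁ c(h)) = g (h σ₂) = (gh) σ₂`,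
  -- so `c(g) c(h)` is the quotient that defines `c(gh)`.
  have h1 := Z.mul_lact (x.arr 0 1) (x.arr 1 2) _ e2 e1
  refine Eq.trans ?_ (h1.symm.trans (Z.lact_congr (x.arr_mul 0 1 2) rfl _ _))
  refine (Z.act_act _ _ _).symm.trans ((congrArg (fun z => Z.act z _) h2).trans ?_)
  refine (Z.lact_act _ _ _ ((e _ _ m2).trans (Z.rng_act _ _).symm) (e _ _ m2)).symm.trans ?_
  exact Z.lact_congr rfl h0 _ _

/-- Every Real generalized homomorphism has a transition cocycle. -/
theorem exists_isTransition (Z : RealGenHom G (ofGroup S)) :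
    ∃ (U : NerveCover.Adm G) (s : _) (c : _), Z.IsTransition U.cov.nat s c := by
  obtain ⟨B, σ, hσ, hbar⟩ := Z.exists_realCover
  have hB : ∀ (a : Fin (0 + 1) → B.J) x, x ∈ (ofBase B).base a → x ∈ B.U (a 0) := fun a x hx => by
    have := hx 0
    rwa [Nerve.obj_ofObj] at this
  exact ⟨⟨ofBase B, 2, le_rfl, hasSimplicialStructure_ofBase B 2⟩,
    Z.exists_isTransition_of_base (ofBase B)
      (fun a => (σ (a 0)).comp (ContinuousMap.inclusion (hB a))) (fun a x => hσ _ _)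
      fun a x hx => hbar _ _ (hB a x hx)⟩

/-- The class of the transition cocycles of a Real generalized homomorphism. -/
noncomputable def cechClass (Z : RealGenHom G (ofGroup S)) : CechHR1 G S :=
  CechHR1.mk Z.exists_isTransition.choose Z.exists_isTransition.choose_spec.choose_spec.choose

theorem cechClass_eq {Z Z' : RealGenHom G (ofGroup S)} (i : Iso Z Z') {U : NerveCover.Adm G} {s c}
    (H : Z'.IsTransition U.cov.nat s c) : Z.cechClass = CechHR1.mk U c :=
  Z.exists_isTransition.choose_spec.choose_spec.choose_spec.mk_eq i H

/-- Adjusting the sections of `Z` by the coboundary makes the cocycles equal. This serves both for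
the inverse map to be well defined and for it to recover the class of `Z`. -/
theorem IsTransition.homMk_eq {Z Z' : RealGenHom G (ofGroup S)} {U : NerveCover G} {s s' c c'}
    (H : Z.IsTransition U.nat s c) (H' : Z'.IsTransition U.nat s' c') (h : c ≈ c') :
    HomRG.mk Z = HomRG.mk Z' := by
  obtain ⟨s'', H''⟩ := H.of_equiv h
  exact Quotient.sound (H''.nonempty_iso H')

end Group

/-! ### Transition cocycles of sums and inverses -/

section CommGroup

variable {G : RealGroupoid.{u}} {S : Type u} [CommGroup S] [TopologicalSpace S] [RealGroup S]
  {Z Z' : RealGenHom G (ofGroup S)} {V : PreSimplicialCover G}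
  {s : ∀ j : (V.cov 0).J, C((V.cov 0).U j, Z.Z)} {s' : ∀ j : (V.cov 0).J, C((V.cov 0).U j, Z'.Z)}
  {c c' : V.ZR1 S}

/-- The pairs `[s_j, s'_j]` are local sections of the sum, and the factors `c`, `c'` produced in the
two components can be collected in the second one. -/
theorem IsTransition.exists_sum (H : Z.IsTransition V s c) (H' : Z'.IsTransition V s' c') :
    ∃ t, (Z.sum Z').IsTransition V t (c * c') := by
  have hr : ∀ j x, Z.rng (s j x) = Z'.rng (s' j x) := fun j x =>
    (H.rng_s j x).trans (H'.rng_s j x).symm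
  refine ⟨fun j => ⟨fun x => RealBibundle.sumMk _ _ ⟨(s j x, s' j x), hr j x⟩,
    (RealBibundle.isOpenQuotientMap_sumMk _ _).continuous.comp
      (Continuous.subtype_mk (by fun_prop) _)⟩, fun j x => H.rng_s j x, fun j x hx => ?_,
    fun j x hx e => ?_⟩
  · exact congrArg (RealBibundle.sumMk _ _)
      (Subtype.ext (Prod.ext (H.s_bar j x hx) (H'.s_bar j x hx)))
  · have m0 := V.face_mem (ε 0) j x hx
    have h := H.lact_s j x hx ((x.s_arr 0 1).trans (H.rng_s _ ⟨_, m0⟩).symm)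
    have h' := H'.lact_s j x hx ((x.s_arr 0 1).trans (H'.rng_s _ ⟨_, m0⟩).symm)
    -- Moving `t = c` across the pair: `[s c, s' c'] = [s, s' c' c]`.
    refine RealBibundle.sumMk_eq (c.1.1 j ⟨x, hx⟩) ?_ ?_
    · refine Eq.trans ?_ (congrArg (fun z => Z.act z _) h).symm
      rw [Z.act_act, mul_inv_cancel, Z.act_one]
    · refine Eq.trans ?_ (congrArg (fun z => Z'.act z _) h').symm
      rw [Z'.act_act, mul_comm]
      rfl

/-- The same sections serve: `s · c` in `Z` is the action of `c⁻¹` on `s` in the inverse. -/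
theorem IsTransition.inv (H : Z.IsTransition V s c) : Z.inv.IsTransition V s c⁻¹ where
  rng_s := H.rng_s
  s_bar := H.s_bar
  lact_s j x hx e := (H.lact_s j x hx e).trans
    (congrArg (Z.act _) (_root_.inv_inv (c.1.1 j ⟨x, hx⟩)).symm)

end CommGroup

end RealGenHom

/-! ### The bijection and the group structure -/

namespace HomRG

open RealGroupoid (ofGroup)

variable {G : RealGroupoid.{u}} {S : Type u}

section Group

variable [Group S] [TopologicalSpace S] [RealGroup S]

/-- The isomorphism class of the bundles defined by the cocycles in a Čech class. -/
noncomputable def ofCech : CechHR1 G S → HomRG G (ofGroup S) :=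
  Quot.lift (fun p => Quotient.lift (fun c => HomRG.mk (NerveCover.genHom c))
    (fun c c' h => (NerveCover.isTransition_genHom c).homMk_eq
      (NerveCover.isTransition_genHom c') h) p.2) (by
    rintro _ _ ⟨U, W, θ, x⟩
    induction x using Quotient.inductionOn with | _ c
    -- Restricted along the refinement, the sections of the bundle of `c` have the restricted
    -- cocycle as transition cocycle, hence that bundle is isomorphic to the one built from the
    -- restriction.
    exact ((NerveCover.isTransition_genHom c).refine θ.nat).homMk_eq
      (NerveCover.isTransition_genHom _) (Setoid.refl _))

variable (G S) in
/-- The bijection between Real generalized homomorphisms to `S` and Real Čech classes. -/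
noncomputable def equivCech : HomRG G (ofGroup S) ≃ CechHR1 G S where
  toFun := Quotient.lift RealGenHom.cechClass fun _ Z' ⟨i⟩ =>
    RealGenHom.cechClass_eq i Z'.exists_isTransition.choose_spec.choose_spec.choose_spec
  invFun := ofCech
  left_inv z := by
    induction z using Quotient.inductionOn with | _ Z
    obtain ⟨U, s, c, H⟩ := Z.exists_isTransition
    refine (congrArg ofCech (RealGenHom.cechClass_eq (Setoid.refl Z).some H)).trans ?_
    exact (NerveCover.isTransition_genHom c).homMk_eq H (Setoid.refl _)
  right_inv a := by
    induction a using CechHR1.ind with | _ U x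
    induction x using Quotient.inductionOn with | _ c
    exact RealGenHom.cechClass_eq (Setoid.refl (NerveCover.genHom c)).some
      (NerveCover.isTransition_genHom c)

theorem equivCech_mk {Z : RealGenHom G (ofGroup S)} {U : NerveCover.Adm G} {s c}
    (H : Z.IsTransition U.cov.nat s c) : equivCech G S (mk Z) = CechHR1.mk U c :=
  RealGenHom.cechClass_eq (Setoid.refl Z).some H

end Group

section CommGroup

variable [CommGroup S] [TopologicalSpace S] [RealGroup S]

/-- Both cocycles are first restricted to the cover by intersections, where the product of Čech
classes is computed by multiplying cocycles. -/
theorem equivCech_sum (Z Z' : RealGenHom G (ofGroup S)) :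
    equivCech G S (mk (Z.sum Z')) = equivCech G S (mk Z) * equivCech G S (mk Z') := by
  obtain ⟨U, s, c, H⟩ := Z.exists_isTransition
  obtain ⟨U', s', c', H'⟩ := Z'.exists_isTransition
  have h := H.refine (NerveCover.prodFst U.cov U'.cov).nat
  have h' := H'.refine (NerveCover.prodSnd U.cov U'.cov).nat
  obtain ⟨t, ht⟩ := h.exists_sum h'
  rw [equivCech_mk (U := U.prod U') ht, equivCech_mk (U := U.prod U') h,
    equivCech_mk (U := U.prod U') h']
  exact (CechHR1.of_mul (S := S) (U.prod U') (Quotient.mk _ _) (Quotient.mk _ _)).symm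

theorem equivCech_inv (Z : RealGenHom G (ofGroup S)) :
    equivCech G S (mk Z.inv) = (equivCech G S (mk Z))⁻¹ := by
  obtain ⟨U, s, c, H⟩ := Z.exists_isTransition
  exact (equivCech_mk H.inv).trans (congrArg Inv.inv (equivCech_mk H)).symm

end CommGroup

end HomRG

theorem mainTheorem4 (G : RealGroupoid.{u}) :
    (∀ (S : Type u) [CommGroup S] [TopologicalSpace S] [RealGroup S],
      ∃ _ : CommGroup (HomRG G (RealGroupoid.ofGroup S)),
        (∀ Z Z' : RealGenHom G (RealGroupoid.ofGroup S),
          HomRG.mk Z * HomRG.mk Z' = HomRG.mk (Z.sum Z')) ∧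
        (∀ Z : RealGenHom G (RealGroupoid.ofGroup S), (HomRG.mk Z)⁻¹ = HomRG.mk Z.inv) ∧
        ∃ e : HomRG G (RealGroupoid.ofGroup S) ≃* CechHR1 G S,
          ∀ Z : RealGenHom G (RealGroupoid.ofGroup S),
            (∃ (U : NerveCover.Adm G) (s : _) (c : _), Z.IsTransition U.cov.nat s c) ∧
            ∀ (U : NerveCover.Adm G) (s : _) (c : _), Z.IsTransition U.cov.nat s c →
              e (HomRG.mk Z) = CechHR1.mk U c) ∧
    (∀ (S : Type u) [Group S] [TopologicalSpace S] [RealGroup S],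
      ∃ e : HomRG G (RealGroupoid.ofGroup S) ≃ CechHR1 G S,
        ∀ Z : RealGenHom G (RealGroupoid.ofGroup S),
          (∃ (U : NerveCover.Adm G) (s : _) (c : _), Z.IsTransition U.cov.nat s c) ∧
          ∀ (U : NerveCover.Adm G) (s : _) (c : _), Z.IsTransition U.cov.nat s c →
            e (HomRG.mk Z) = CechHR1.mk U c) := by
  refine ⟨fun S _ _ _ => ?_, fun S _ _ _ => ⟨HomRG.equivCech G S, fun Z =>
    ⟨Z.exists_isTransition, fun U s c H => HomRG.equivCech_mk H⟩⟩⟩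
  let e := HomRG.equivCech G S
  -- Product and inverse are pulled back along the bijection `e`, so the group axioms come for free
  -- and `e` is an isomorphism. It remains to see that the pulled-back operations are the geometric
  -- ones, that is, that `e` respects the latter.
  let _ := e.commGroup
  refine ⟨e.commGroup, fun Z Z' => ?_, fun Z => ?_, e.mulEquiv, fun Z =>
    ⟨Z.exists_isTransition, fun U s c H => HomRG.equivCech_mk H⟩⟩
  · exact e.symm_apply_eq.2 (HomRG.equivCech_sum Z Z').symm
  · exact e.symm_apply_eq.2 (HomRG.equivCech_inv Z).symm
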